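/- Notation. For a matrix $M$, $\|M\|$ is the spectral norm, $\|M\|_F$ the Frobenius norm, $M[J,:]$ the matrix with rows indexed by $J$, $\lambda_k(M)$ the $k$-th largest singular value, $\lambda_{\max}(M)=\lambda_1(M)$, and, for $M$ of rank $K$, $\lambda_{\min}(M)=\lambda_K(M)$ and $\kappa(M)=\lambda_{\max}(M)/\lambda_{\min}(M)$. Let $n, K\ge 1$, let $\mathbf B\in[0,1]^{K\times K}$ be symmetric of full rank, and let $\mathbf\Theta\in[0,1]^{n\times K}$ be such that every row of $\mathbf\Theta$ sums to $1$ and for each $k\in\{1,\dots,K\}$ there is a pure node $i$, i.e. $\theta_{ik}=1$. Put $\mathbf P=\mathbf\Theta\mathbf B\mathbf\Theta^{\mathrm T}$, and let $\mathbf A\in\mathbb R^{n\times n}$ be a symmetric matrix. Let $\mathbf U$ and $\hat{\mathbf U}$ be $n\times K$ matrices whose columns are orthonormal eigenvectors of $\mathbf P$ and of $\mathbf A$, respectively, for the $K$ eigenvalues of largest absolute value, and let $\mathbf F\in\mathbb R^{K\times K}$ be the matrix with $\mathbf U=\mathbf\Theta\mathbf F$. For $i=1,\dots,n$ let $$\beta_i(\mathbf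 A,\mathbf P)=23K^{1/2}\kappa(\mathbf P)\,\frac{\|\mathbf e_i^{\mathrm T}\mathbf A\|_F\,\|\mathbf A-\mathbf P\|}{\lambda_K^2(\mathbf P)}+\frac{\|\mathbf e_i^{\mathrm T}(\mathbf A-\mathbf P)\mathbf U\|_F}{\lambda_K(\mathbf P)},\qquad \beta(\mathbf A,\mathbf P)=\max_{1\le i\le n}\beta_i(\mathbf A,\mathbf P).$$ The preconditioned successive projection algorithm (SPA) with input $(\mathbf X,K)$, where $\mathbf X$ is a $K\times n$ matrix with columns $x_1,\dots,x_n$ of rank $K$, finds the minimum-volume origin-centred ellipsoid $\{x: x^{\mathrm T}\mathbf Lx\le1\}$, $\mathbf L\succ0$, that contains $x_1,\dots,x_n$, replaces $\mathbf X$ by $\mathbf L^{1/2}\mathbf X$, and then $K$ times selects (breaking ties in any way) the index of a column of maximal Euclidean norm and projects all columns on the subspace orthogonal to the selected one. Its output is the list $J$ of selected indices. There are absolute constants $c_1>0$ and $C_0>0$ such that, for all such data, if $$\|\mathbf A-\mathbf P\|\le\tfrac12\lambda_K(\mathbf P)\qquad\text{and}\qquad \beta(\mathbf A,\mathbf P)\le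 c_1\frac{\lambda_{\min}(\mathbf F)}{K^{1/2}},$$ then there is an orthogonal $K\times K$ matrix $\mathbf O_{\mathbf P}$ with $\|\mathbf e_i^{\mathrm T}(\hat{\mathbf U}-\mathbf U\mathbf O_{\mathbf P})\|_F\le\beta_i(\mathbf A,\mathbf P)$ for all $i$, such that the following holds. The SPA with input $(\hat{\mathbf U}^{\mathrm T},K)$ has an output, every output $J$ consists of $K$ distinct indices, and for every output $J$ there is a permutation $\pi$ of $\{1,\dots,K\}$ such that the rows $\hat{\mathbf f}_j$ of $\hat{\mathbf F}=\hat{\mathbf U}[J,:]$ and the rows $\mathbf f_j$ of $\mathbf F\mathbf O_{\mathbf P}$ satisfy $$\|\hat{\mathbf f}_j-\mathbf f_{\pi(j)}\|_2\le C_0\,\kappa(\mathbf F)\,\beta(\mathbf A,\mathbf P),\qquad j=1,\dots,K,$$ and consequently $$\|\hat{\mathbf F}-\mathrm\Pi_{\mathbf F}\mathbf F\mathbf O_{\mathbf P}\|_F\le C_0K^{1/2}\,\kappa(\mathbf F)\,\beta(\mathbf A,\mathbf P),$$ where $\mathrm\Pi_{\mathbf F}$ is the permutation matrix of $\pi$.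 -/

import Mathlib

open scoped Matrix

namespace SPOC

/-- The Euclidean norm of the `i`-th row `eᵢᵀ M` of a matrix. -/
noncomputable def rowNorm {m d : ℕ} (M : Matrix (Fin m) (Fin d) ℝ) (i : Fin m) : ℝ :=
  ‖WithLp.toLp 2 (M i)‖

/-- The Frobenius norm. -/
noncomputable def frobNorm {m d : ℕ} (M : Matrix (Fin m) (Fin d) ℝ) : ℝ :=
  √(∑ i, ∑ j, M i j ^ 2)

/-- The spectral (operator) norm of a square matrix. -/
noncomputable def specNorm {m : ℕ} (M : Matrix (Fin m) (Fin m) ℝ) : ℝ :=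
  ‖Matrix.toEuclideanCLM (n := Fin m) (𝕜 := ℝ) M‖

/-- The `k`-th largest singular value of a matrix, counted with multiplicity, `k = 1, 2, …`. -/
noncomputable def singVal {m d : ℕ} (M : Matrix (Fin m) (Fin d) ℝ) (k : ℕ) : ℝ :=
  (Matrix.toEuclideanLin M).singularValues (k - 1)

/-- The condition number of a matrix of rank `K`: the ratio of its largest singular value to its
smallest non-zero one, the `K`-th. -/
noncomputable def condNum (K : ℕ) {m d : ℕ} (M : Matrix (Fin m) (Fin d) ℝ) : ℝ :=
  singVal M 1 / singVal M K

/-- `P = Θ B Θᵀ` is the matrix of edge probabilities of a mixed membership stochastic block model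
with `n` nodes and `K` communities which satisfies the identifiability conditions. -/
structure IsIdentifiableMMSB {n K : ℕ} (Θ : Matrix (Fin n) (Fin K) ℝ)
    (B : Matrix (Fin K) (Fin K) ℝ) (P : Matrix (Fin n) (Fin n) ℝ) : Prop where
  model : P = Θ * B * Θᵀ
  memb_mem : ∀ i k, Θ i k ∈ Set.Icc (0 : ℝ) 1
  memb_sum : ∀ i, ∑ k, Θ i k = 1
  pure_node : ∀ k, ∃ i, Θ i k = 1
  comm_mem : ∀ k l, B k l ∈ Set.Icc (0 : ℝ) 1
  comm_symm : B.IsSymm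
  comm_rank : B.rank = K

/-- The columns of `U` are orthonormal eigenvectors of the symmetric matrix `M` for `K` leading
eigenvalues, that is, for `K` eigenvalues of largest absolute value (with multiplicity): each
eigenvalue with an eigenvector orthogonal to the columns of `U` is at most as large in absolute
value as all the chosen ones. -/
def IsLeadingEigenvectors {n K : ℕ} (M : Matrix (Fin n) (Fin n) ℝ)
    (U : Matrix (Fin n) (Fin K) ℝ) : Prop :=
  Uᵀ * U = 1 ∧ ∃ l : Fin K → ℝ, M * U = U * Matrix.diagonal l ∧
    ∀ (μ : ℝ) (v : Fin n → ℝ), v ≠ 0 → M *ᵥ v = μ • v → Uᵀ *ᵥ v = 0 → ∀ k, |μ| ≤ |l k|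

/-- The error term of the `i`-th row of the spectral embedding, `βᵢ(A, P)`, where the columns of
`U` are the `K` leading eigenvectors of `P`. -/
noncomputable def betaRow {n K : ℕ} (A P : Matrix (Fin n) (Fin n) ℝ)
    (U : Matrix (Fin n) (Fin K) ℝ) (i : Fin n) : ℝ :=
  23 * √(K : ℝ) * condNum K P * (rowNorm A i * specNorm (A - P) / singVal P K ^ 2)
    + rowNorm ((A - P) * U) i / singVal P K

/-- `β(A, P) = maxᵢ βᵢ(A, P)`. -/
noncomputable def beta {n K : ℕ} (A P : Matrix (Fin n) (Fin n) ℝ)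
    (U : Matrix (Fin n) (Fin K) ℝ) : ℝ :=
  ⨆ i, betaRow A P U i

/-- The residuals of the columns of `X` after the first `k` steps of the successive projection
algorithm which selects the columns `J 0, J 1, …`: each step projects all the residuals on the
subspace orthogonal to the residual of the selected column. -/
noncomputable def spaResidual {d n : ℕ} (X : Matrix (Fin d) (Fin n) ℝ) (J : ℕ → Fin n) :
    ℕ → Fin n → EuclideanSpace ℝ (Fin d)
  | 0, j => WithLp.toLp 2 (Xᵀ j)
  | k + 1, j =>
    (Submodule.span ℝ {spaResidual X J k (J k)})ᗮ.starProjection (spaResidual X J k j)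

/-- `J` is an output of the successive projection algorithm with input `(X, r)`: each of the `r`
steps selects a column whose residual has maximal norm, ties being broken in any way. -/
def IsSPAOutput {d n r : ℕ} (X : Matrix (Fin d) (Fin n) ℝ) (J : Fin r → Fin n) : Prop :=
  ∃ J' : ℕ → Fin n, (∀ k : Fin r, J k = J' k) ∧
    ∀ k : Fin r, ∀ j, ‖spaResidual X J' k j‖ ≤ ‖spaResidual X J' k (J' k)‖

/-- The origin-centred ellipsoid `{x | xᵀ L x ≤ 1}` contains all the columns of `X`. -/
def IsEnclosingEllipsoid {r n : ℕ} (X : Matrix (Fin r) (Fin n) ℝ)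
    (L : Matrix (Fin r) (Fin r) ℝ) : Prop :=
  L.PosDef ∧ ∀ j, Xᵀ j ⬝ᵥ L *ᵥ Xᵀ j ≤ 1

/-- `{x | xᵀ L x ≤ 1}` is an origin-centred ellipsoid of minimal volume containing all the columns
of `X`; its volume is proportional to `(det L)^(-1/2)`. -/
def IsMinVolEllipsoid {r n : ℕ} (X : Matrix (Fin r) (Fin n) ℝ)
    (L : Matrix (Fin r) (Fin r) ℝ) : Prop :=
  IsEnclosingEllipsoid X L ∧ ∀ L', IsEnclosingEllipsoid X L' → L'.det ≤ L.det

/-- `J` is an output of the preconditioned successive projection algorithm with input `(X, r)`, for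
a matrix `X` with `r` rows: find the minimum volume origin-centred ellipsoid `{x | xᵀ L x ≤ 1}`
containing the columns of `X`, factor `L = Qᵀ Q` (the symmetric square root is one choice; another
one changes `Q X` by an orthogonal transformation only), and run the successive projection
algorithm on `Q X`. -/
def IsPrecondSPAOutput {r n : ℕ} (X : Matrix (Fin r) (Fin n) ℝ) (J : Fin r → Fin n) : Prop :=
  ∃ Q : Matrix (Fin r) (Fin r) ℝ, IsMinVolEllipsoid X (Qᵀ * Q) ∧ IsSPAOutput (Q * X) J

end SPOC

/-! Two independent facts are combined: a row-wise perturbation bound for the leading eigenvectors,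
and a robustness theorem for preconditioned SPA.

Eigenvectors (`exists_orthogonal_rowNorm_le`). Weyl-type bounds keep the chosen eigenvalues of `A`
above half of `singVal P K`. A Davis–Kahan estimate bounds the sines between the two eigenspaces,
and the polar factor of `Uᵀ * V` supplies the aligning orthogonal matrix `O`. An algebraic identity
then writes `V - U * O` as `A` times a matrix of small operator norm plus `(A - P) * U` times a
bounded factor. Both factors act from the right, so the bound can be read off row by row.

SPA (`precondSPA_near_vertices`). Since `U = Θ * F`, the columns of `Uhatᵀ` are `W = (F * O)ᵀ`
applied to points near the rows of `Θ`, which lie in the standard simplex and include all its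
vertices. Minimum volume ellipsoids are equivariant under linear maps, so the preconditioner may be
analysed on these simplex points. There it distorts lengths by at most a factor 2
(`IsMinVolEllipsoid.conditioning_of_near_separable`). The argument uses John's decomposition of the
identity when every point is near a vertex. It then shows that other mixtures fall strictly inside
that ellipsoid, so uniqueness makes them irrelevant.

On well conditioned data SPA selects points near distinct vertices (`spa_near_vertices`): residuals
of unselected vertices remain long and separated, those of selected ones are short, and by the
variance identity a convex combination of nearly maximal norm puts nearly all its weight on one
unselected vertex. The condition number of `F` enters only when the weight error is mapped back
through `W`. -/

namespace SPOC

/-! ### Convexity estimates and the linear structure of SPA residuals. -/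

section SPA

variable {E : Type*} [NormedAddCommGroup E] [InnerProductSpace ℝ E]

/-- The variance identity for a convex combination. -/
lemma sum_mul_norm_sub_sq {ι : Type*} [Fintype ι] (w : ι → ℝ) (hw : ∑ i, w i = 1) (q : ι → E) :
    ∑ i, ∑ j, w i * w j * ‖q i - q j‖ ^ 2 =
      2 * (∑ i, w i * ‖q i‖ ^ 2 - ‖∑ i, w i • q i‖ ^ 2) := by
  have h1 : ‖∑ i, w i • q i‖ ^ 2 = ∑ i, ∑ j, w i * w j * inner ℝ (q i) (q j) := by
    rw [← real_inner_self_eq_norm_sq, sum_inner]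
    refine Finset.sum_congr rfl fun i _ => ?_
    rw [inner_sum]
    refine Finset.sum_congr rfl fun j _ => ?_
    rw [real_inner_smul_left, real_inner_smul_right]; ring
  have h2 : ∀ i j, w i * w j * ‖q i - q j‖ ^ 2 =
      w j * (w i * ‖q i‖ ^ 2) + w i * (w j * ‖q j‖ ^ 2) - 2 * (w i * w j * inner ℝ (q i) (q j)) := by
    intro i j
    rw [norm_sub_sq_real]; ring
  have h3 : ∑ i, ∑ j, w j * (w i * ‖q i‖ ^ 2) = ∑ i, w i * ‖q i‖ ^ 2 := by
    simp_rw [← Finset.sum_mul, hw, one_mul]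
  have h4 : ∑ i, ∑ j, w i * (w j * ‖q j‖ ^ 2) = ∑ i, w i * ‖q i‖ ^ 2 := by
    simp_rw [← Finset.mul_sum, ← Finset.sum_mul, hw, one_mul]
  have h5 : ∑ i, ∑ j, 2 * (w i * w j * inner ℝ (q i) (q j)) =
      2 * ∑ i, ∑ j, w i * w j * inner ℝ (q i) (q j) := by
    simp_rw [← Finset.mul_sum]
  simp_rw [h2, Finset.sum_sub_distrib, Finset.sum_add_distrib]
  rw [h3, h4, h5, h1]
  ring

/-- A convex combination of nearly maximal norm of separated vectors is nearly a vertex. -/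
lemma exists_weight_near_one {ι : Type*} [Fintype ι] [DecidableEq ι] (w : ι → ℝ) (hw0 : ∀ i, 0 ≤ w i)
    (hw : ∑ i, w i = 1) (q : ι → E) (T : Finset ι) {μ δ : ℝ} (hδ : 0 ≤ δ) (hδ' : δ ≤ 1 / 1000)
    (hμ : 1 / 4 ≤ μ) (hμ2 : μ ≤ 2) (hq : ∀ i ∉ T, ‖q i‖ ≤ μ) (hqT : ∀ i ∈ T, ‖q i‖ ≤ 1 / 8)
    (hsum : μ - 4 * δ ≤ ‖∑ i, w i • q i‖)
    (hsep : ∀ i ∉ T, ∀ j ∉ T, i ≠ j → 1 / 8 ≤ ‖q i - q j‖ ^ 2) :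
    ∃ i ∉ T, 1 - 320 * δ ≤ w i := by
  set s := ∑ i ∈ T, w i with hs
  set W := ∑ i ∈ Tᶜ, w i with hW
  have hsW : s + W = 1 := by rw [hs, hW, Finset.sum_add_sum_compl, hw]
  have hle : ‖∑ i, w i • q i‖ ≤ s * (1 / 8) + W * μ := by
    rw [← Finset.sum_add_sum_compl T]
    refine (norm_add_le _ _).trans (add_le_add ?_ ?_)
    · rw [hs, Finset.sum_mul]
      refine norm_sum_le_of_le _ fun i hi => ?_
      rw [norm_smul, Real.norm_of_nonneg (hw0 i)]
      exact mul_le_mul_of_nonneg_left (hqT i hi) (hw0 i)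
    · rw [hW, Finset.sum_mul]
      refine norm_sum_le_of_le _ fun i hi => ?_
      rw [norm_smul, Real.norm_of_nonneg (hw0 i)]
      exact mul_le_mul_of_nonneg_left (hq i (by simpa using hi)) (hw0 i)
  have hs0 : 0 ≤ s := Finset.sum_nonneg fun i _ => hw0 i
  -- The vectors in `T` are shorter than `μ` by at least 1/8, so weight `s` on them costs at least
  -- `s / 8` of norm, while only `4 * δ` may be lost.
  have hs32 : s ≤ 32 * δ := by nlinarith
  have hWl : 1 - 32 * δ ≤ W := by linarith
  have hne : (Tᶜ).Nonempty := by
    by_contra hcon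
    rw [Finset.not_nonempty_iff_eq_empty] at hcon
    rw [hW, hcon, Finset.sum_empty] at hWl
    linarith
  obtain ⟨l, hl, hmax⟩ := Finset.exists_max_image Tᶜ w hne
  refine ⟨l, by simpa using hl, ?_⟩
  -- The mass of the off-diagonal pairs is large unless a single weight dominates. The separation of
  -- the `q i` turns this mass into variance.
  have hpairs : W * (W - w l) ≤ ∑ i ∈ Tᶜ, ∑ j ∈ Tᶜ, if i = j then 0 else w i * w j := by
    rw [hW, Finset.sum_mul]
    refine Finset.sum_le_sum fun i hi => ?_
    have : ∑ j ∈ Tᶜ, (if i = j then 0 else w i * w j) = w i * (W - w i) := by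
      have h3 : ∀ j ∈ Tᶜ, (if i = j then 0 else w i * w j) =
          w i * w j - if i = j then w i * w j else 0 := by
        intro j _; split_ifs <;> ring
      rw [Finset.sum_congr rfl h3, Finset.sum_sub_distrib, ← Finset.mul_sum, Finset.sum_ite_eq,
        if_pos hi]
      ring
    rw [this]
    exact mul_le_mul_of_nonneg_left (by linarith [hmax i hi]) (hw0 i)
  have hvar : (∑ i ∈ Tᶜ, ∑ j ∈ Tᶜ, if i = j then 0 else w i * w j) * (1 / 8) ≤
      ∑ i, ∑ j, w i * w j * ‖q i - q j‖ ^ 2 := by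
    rw [Finset.sum_mul]
    have hnn : ∀ i j, 0 ≤ w i * w j * ‖q i - q j‖ ^ 2 := fun i j =>
      mul_nonneg (mul_nonneg (hw0 i) (hw0 j)) (sq_nonneg _)
    refine le_trans (Finset.sum_le_sum fun i hi => ?_)
      (Finset.sum_le_univ_sum_of_nonneg (s := Tᶜ) fun i => Finset.sum_nonneg fun j _ => hnn i j)
    rw [Finset.sum_mul]
    refine le_trans (Finset.sum_le_sum fun j hj => ?_)
      (Finset.sum_le_univ_sum_of_nonneg (s := Tᶜ) fun j => hnn i j)
    split_ifs with hij
    · simpa using hnn i j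
    · exact mul_le_mul_of_nonneg_left (hsep i (by simpa using hi) j (by simpa using hj) hij)
        (mul_nonneg (hw0 i) (hw0 j))
  rw [sum_mul_norm_sub_sq w hw q] at hvar
  have hup : ∑ i, w i * ‖q i‖ ^ 2 ≤ μ ^ 2 := by
    calc ∑ i, w i * ‖q i‖ ^ 2 ≤ ∑ i, w i * μ ^ 2 := by
          refine Finset.sum_le_sum fun i _ => mul_le_mul_of_nonneg_left ?_ (hw0 i)
          refine pow_le_pow_left₀ (norm_nonneg _) ?_ 2
          by_cases hi : i ∈ T
          · exact (hqT i hi).trans (by linarith)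
          · exact hq i hi
      _ = μ ^ 2 := by rw [← Finset.sum_mul, hw, one_mul]
  have hlow : (μ - 4 * δ) ^ 2 ≤ ‖∑ i, w i • q i‖ ^ 2 :=
    pow_le_pow_left₀ (by linarith) hsum 2
  -- The variance is at most `2 * (μ ^ 2 - (μ - 4 * δ) ^ 2) ≤ 16 * μ * δ ≤ 32 * δ`, and the
  -- separation 1/8 contributes a factor 8.
  have hfin : W * (W - w l) ≤ 256 * δ := by nlinarith
  have hW1 : W ≤ 1 := by linarith
  by_contra hcon
  push Not at hcon
  nlinarith

variable {d n : ℕ}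

/-- The linear map which sends the columns of `X` to their residuals after `k` steps. -/
noncomputable def spaMap (X : Matrix (Fin d) (Fin n) ℝ) (J : ℕ → Fin n) :
    ℕ → EuclideanSpace ℝ (Fin d) →ₗ[ℝ] EuclideanSpace ℝ (Fin d)
  | 0 => LinearMap.id
  | k + 1 => ((Submodule.span ℝ {spaResidual X J k (J k)})ᗮ.starProjection).toLinearMap ∘ₗ
      spaMap X J k

lemma spaMap_col (X : Matrix (Fin d) (Fin n) ℝ) (J : ℕ → Fin n) (k : ℕ) (j : Fin n) :
    spaMap X J k (WithLp.toLp 2 (Xᵀ j)) = spaResidual X J k j := by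
  induction k with
  | zero => rfl
  | succ k ih => simp [spaMap, spaResidual, ih]

lemma norm_spaMap_le (X : Matrix (Fin d) (Fin n) ℝ) (J : ℕ → Fin n) (k : ℕ)
    (v : EuclideanSpace ℝ (Fin d)) : ‖spaMap X J k v‖ ≤ ‖v‖ := by
  induction k with
  | zero => exact le_rfl
  | succ k ih => exact (Submodule.norm_starProjection_apply_le _ _).trans ih

lemma spaMap_col_eq_zero (X : Matrix (Fin d) (Fin n) ℝ) (J : ℕ → Fin n) {k i : ℕ} (hi : i < k) :
    spaMap X J k (WithLp.toLp 2 (Xᵀ (J i))) = 0 := by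
  induction k with
  | zero => omega
  | succ k ih =>
    rcases Nat.lt_succ_iff_lt_or_eq.mp hi with h | rfl
    · simp [spaMap, ih h]
    · simp only [spaMap, LinearMap.comp_apply, spaMap_col, ContinuousLinearMap.coe_coe]
      rw [Submodule.starProjection_apply_eq_zero_iff]
      exact Submodule.le_orthogonal_orthogonal _ (Submodule.mem_span_singleton_self _)

/-- Each projection subtracts a multiple of a residual, which is by induction a selected column
minus a combination of earlier ones. Residuals can thus be bounded below by distances to the span of
the original selected columns. -/
lemma spaMap_eq_sub_sum (X : Matrix (Fin d) (Fin n) ℝ) (J : ℕ → Fin n) (k : ℕ)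
    (v : EuclideanSpace ℝ (Fin d)) :
    ∃ a : ℕ → ℝ, spaMap X J k v = v - ∑ i ∈ Finset.range k, a i • WithLp.toLp 2 (Xᵀ (J i)) := by
  induction k generalizing v with
  | zero => exact ⟨0, by simp [spaMap]⟩
  | succ k ih =>
    obtain ⟨a, ha⟩ := ih v
    obtain ⟨b, hb⟩ := ih (WithLp.toLp 2 (Xᵀ (J k)))
    obtain ⟨c, hc⟩ := Submodule.mem_span_singleton.mp
      (Submodule.starProjection_apply_mem (Submodule.span ℝ {spaResidual X J k (J k)})
        (spaMap X J k v))
    refine ⟨fun i => if i = k then c else a i - c * b i, ?_⟩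
    simp only [spaMap, LinearMap.comp_apply, ContinuousLinearMap.coe_coe,
      Submodule.starProjection_orthogonal_val]
    rw [← hc, ← spaMap_col, hb, ha, Finset.sum_range_succ, if_pos rfl]
    have : ∑ i ∈ Finset.range k, (if i = k then c else a i - c * b i) • WithLp.toLp 2 (Xᵀ (J i)) =
        ∑ i ∈ Finset.range k, a i • WithLp.toLp 2 (Xᵀ (J i)) -
          c • ∑ i ∈ Finset.range k, b i • WithLp.toLp 2 (Xᵀ (J i)) := by
      rw [Finset.smul_sum, ← Finset.sum_sub_distrib]
      refine Finset.sum_congr rfl fun i hi => ?_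
      rw [if_neg (Finset.mem_range.mp hi).ne, sub_smul, mul_smul]
    rw [this, smul_sub]
    abel

/-- The successive projection algorithm has an output. -/
lemma exists_isSPAOutput [NeZero n] (X : Matrix (Fin d) (Fin n) ℝ) (r : ℕ) :
    ∃ J : Fin r → Fin n, IsSPAOutput X J := by
  have hmax : ∀ f : Fin n → EuclideanSpace ℝ (Fin d), ∃ i, ∀ j, ‖f j‖ ≤ ‖f i‖ := fun f =>
    Finite.exists_max fun i => ‖f i‖
  choose sel hsel using hmax
  let res : ℕ → Fin n → EuclideanSpace ℝ (Fin d) := fun k => Nat.rec (fun j => WithLp.toLp 2 (Xᵀ j))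
    (fun _ f j => (Submodule.span ℝ {f (sel f)})ᗮ.starProjection (f j)) k
  have hres : ∀ k, spaResidual X (fun k => sel (res k)) k = res k := by
    intro k
    induction k with
    | zero => rfl
    | succ k ih =>
      funext j
      simp only [spaResidual, ih]
      rfl
  refine ⟨fun k => sel (res k), fun k => sel (res k), fun _ => rfl, fun k j => ?_⟩
  rw [hres]
  exact hsel _ j

end SPA

/-! ### Robustness of SPA on well conditioned data. -/

section SPA

variable {K : ℕ}

/-- In a convex combination close to a vertex, the distance to that vertex is controlled by its
weight. -/
lemma norm_sub_single_le (h : EuclideanSpace ℝ (Fin K)) (h0 : ∀ l, 0 ≤ h l) (h1 : ∑ l, h l = 1)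
    (l : Fin K) : ‖h - EuclideanSpace.single l 1‖ ≤ 2 * (1 - h l) := by
  have hl1 : h l ≤ 1 := h1 ▸ Finset.single_le_sum (fun i _ => h0 i) (Finset.mem_univ l)
  refine abs_le_of_sq_le_sq' ?_ (by linarith) |>.2
  rw [EuclideanSpace.norm_sq_eq, ← Finset.add_sum_erase _ _ (Finset.mem_univ l)]
  have h2 : ∑ i ∈ Finset.univ.erase l, h i = 1 - h l := by
    rw [← h1, ← Finset.add_sum_erase _ _ (Finset.mem_univ l)]; ring
  have h3 : ∑ i ∈ Finset.univ.erase l, ‖(h - EuclideanSpace.single l (1 : ℝ)) i‖ ^ 2 ≤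
      (1 - h l) * (1 - h l) := by
    rw [← h2, Finset.sum_mul]
    refine Finset.sum_le_sum fun i hi => ?_
    have hil : i ≠ l := Finset.ne_of_mem_erase hi
    have : h i ≤ ∑ i ∈ Finset.univ.erase l, h i :=
      Finset.single_le_sum (fun i _ => h0 i) hi
    simp only [PiLp.sub_apply, PiLp.single_apply, if_neg hil, sub_zero, Real.norm_eq_abs, sq_abs]
    nlinarith [h0 i]
  have h4 : ‖(h - EuclideanSpace.single l (1 : ℝ)) l‖ ^ 2 = (1 - h l) * (1 - h l) := by
    simp only [PiLp.sub_apply, PiLp.single_apply, if_true, Real.norm_eq_abs, sq_abs]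
    ring
  rw [h4]
  nlinarith [sq_nonneg (1 - h l)]

/-- Vectors supported off a set of coordinates are far from the span of small perturbations of
the corresponding basis vectors. -/
lemma norm_le_norm_sub_perturbed (w : EuclideanSpace ℝ (Fin K)) (k : ℕ) (p : ℕ → Fin K)
    (hk : k ≤ K) (hp : Set.InjOn p (Finset.range k)) (hw : ∀ i < k, w (p i) = 0) (a : ℕ → ℝ)
    (e : ℕ → EuclideanSpace ℝ (Fin K)) {δ : ℝ} (he : ∀ i < k, ‖e i‖ ≤ δ) (hδ : √K * δ ≤ 1 / 2)
    (hδ0 : 0 ≤ δ) :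
    ‖w‖ / 2 ≤ ‖w - ∑ i ∈ Finset.range k, a i • (EuclideanSpace.single (p i) 1 + e i)‖ := by
  set g := ∑ i ∈ Finset.range k, a i • EuclideanSpace.single (p i) (1 : ℝ) with hg
  set f := ∑ i ∈ Finset.range k, a i • e i with hf
  have hsplit : ∑ i ∈ Finset.range k, a i • (EuclideanSpace.single (p i) 1 + e i) = g + f := by
    rw [hg, hf, ← Finset.sum_add_distrib]
    exact Finset.sum_congr rfl fun i _ => smul_add _ _ _
  have hwg : inner ℝ w g = 0 := by
    rw [hg, inner_sum]
    refine Finset.sum_eq_zero fun i hi => ?_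
    rw [real_inner_smul_right, EuclideanSpace.inner_single_right]
    simp [hw i (Finset.mem_range.mp hi)]
  have hgg : ‖g‖ ^ 2 = ∑ i ∈ Finset.range k, a i ^ 2 := by
    rw [← real_inner_self_eq_norm_sq, hg, sum_inner]
    refine Finset.sum_congr rfl fun i hi => ?_
    rw [inner_sum, Finset.sum_eq_single i]
    · rw [real_inner_smul_left, real_inner_smul_right, EuclideanSpace.inner_single_left]
      simp [pow_two]
    · intro j hj hji
      have : p i ≠ p j := fun hij => hji (hp hj hi hij.symm)
      rw [real_inner_smul_left, real_inner_smul_right, EuclideanSpace.inner_single_left]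
      simp [this]
    · exact fun h => absurd hi h
  -- Cauchy–Schwarz on the coefficients costs the factor `√K`; this is where the `K^(1/2)` in the
  -- smallness condition is needed.
  have hff : ‖f‖ ≤ ‖g‖ / 2 := by
    have h1 : ‖f‖ ≤ (∑ i ∈ Finset.range k, |a i|) * δ := by
      rw [hf, Finset.sum_mul]
      refine norm_sum_le_of_le _ fun i hi => ?_
      rw [norm_smul, Real.norm_eq_abs]
      exact mul_le_mul_of_nonneg_left (he i (Finset.mem_range.mp hi)) (abs_nonneg _)
    have h2 : ∑ i ∈ Finset.range k, |a i| ≤ √K * ‖g‖ := by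
      refine abs_le_of_sq_le_sq' ?_ (by positivity) |>.2
      rw [mul_pow, Real.sq_sqrt (Nat.cast_nonneg _), hgg]
      refine (sq_sum_le_card_mul_sum_sq).trans ?_
      simp only [Finset.card_range, sq_abs]
      exact mul_le_mul_of_nonneg_right (by exact_mod_cast hk)
        (Finset.sum_nonneg fun i _ => sq_nonneg _)
    nlinarith [mul_le_mul_of_nonneg_right h2 hδ0, norm_nonneg g]
  have hpy : ‖w - g‖ ^ 2 = ‖w‖ ^ 2 + ‖g‖ ^ 2 := by
    rw [norm_sub_sq_real, hwg]; ring
  have hlow : (‖w‖ + ‖g‖) / 2 ≤ ‖w - g‖ := by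
    refine abs_le_of_sq_le_sq' ?_ (norm_nonneg _) |>.2
    nlinarith [sq_nonneg (‖w‖ - ‖g‖), sq_nonneg ‖w‖, sq_nonneg ‖g‖]
  rw [hsplit, ← sub_sub]
  linarith [norm_sub_norm_le (w - g) f]

/-- One step of the successive projection algorithm: if all the previously selected columns are
close to distinct vertices, then the next one is close to a further vertex. -/
lemma spa_step {d n : ℕ} (Y : EuclideanSpace ℝ (Fin K) →ₗ[ℝ] EuclideanSpace ℝ (Fin d))
    (hYl : ∀ v, ‖v‖ / 2 ≤ ‖Y v‖) (hYu : ∀ v, ‖Y v‖ ≤ 2 * ‖v‖)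
    (h m : Fin n → EuclideanSpace ℝ (Fin K)) (h0 : ∀ j l, 0 ≤ h j l) (h1 : ∀ j, ∑ l, h j l = 1)
    (hpure : ∀ l, ∃ j, h j = EuclideanSpace.single l 1) {δ : ℝ} (hδ0 : 0 ≤ δ)
    (hm : ∀ j, ‖m j‖ ≤ δ) (hδ : √K * δ ≤ 1 / 30000) (X : Matrix (Fin d) (Fin n) ℝ)
    (hX : ∀ j, WithLp.toLp 2 (Xᵀ j) = Y (h j + m j)) (J : ℕ → Fin n) {k : ℕ} (hk : k < K)
    (hJ : ∀ j, ‖spaResidual X J k j‖ ≤ ‖spaResidual X J k (J k)‖) (p : ℕ → Fin K)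
    (hp : Set.InjOn p (Finset.range k)) (hhp : ∀ i < k, 1 - 320 * δ ≤ h (J i) (p i)) :
    ∃ l, (∀ i < k, p i ≠ l) ∧ 1 - 320 * δ ≤ h (J k) l := by
  have hK1 : 1 ≤ √(K : ℝ) := by
    rw [Real.one_le_sqrt]; exact_mod_cast (by omega : 1 ≤ K)
  have hδ1 : δ ≤ 1 / 30000 := by nlinarith
  set R := spaMap X J k with hR
  set q : Fin K → EuclideanSpace ℝ (Fin d) := fun l => R (Y (EuclideanSpace.single l 1)) with hq
  set T := (Finset.range k).image p with hT
  have hTmem : ∀ l, l ∉ T ↔ ∀ i < k, p i ≠ l := by intro l; simp [hT]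
  let e : ℕ → EuclideanSpace ℝ (Fin K) := fun i =>
    (h (J i) - EuclideanSpace.single (p i) 1) + m (J i)
  -- A weight deficit of `320 * δ` moves the mixture at most `640 * δ` from its vertex, and the
  -- noise `m` adds one more `δ`.
  have he : ∀ i < k, ‖e i‖ ≤ 641 * δ := fun i hi => by
    refine (norm_add_le _ _).trans ?_
    linarith [norm_sub_single_le (h (J i)) (h0 _) (h1 _) (p i), hm (J i), hhp i hi]
  have hcol : ∀ i, WithLp.toLp 2 (Xᵀ (J i)) = Y (EuclideanSpace.single (p i) 1 + e i) := by
    intro i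
    rw [hX]
    congr 1
    simp only [e]
    abel
  -- Modulo the selected columns, a vector supported off the selected vertices keeps half its norm.
  -- The lower bound for `Y` costs another half.
  have hlow : ∀ w : EuclideanSpace ℝ (Fin K), (∀ i < k, w (p i) = 0) → ‖w‖ / 4 ≤ ‖R (Y w)‖ := by
    intro w hw
    obtain ⟨a, ha⟩ := spaMap_eq_sub_sum X J k (Y w)
    have : R (Y w) =
        Y (w - ∑ i ∈ Finset.range k, a i • (EuclideanSpace.single (p i) 1 + e i)) := by
      rw [hR, ha, map_sub, map_sum]
      simp_rw [map_smul, hcol]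
    rw [this]
    have h3 := norm_le_norm_sub_perturbed w k p hk.le hp hw a e he (by nlinarith) (by positivity)
    linarith [hYl (w - ∑ i ∈ Finset.range k, a i • (EuclideanSpace.single (p i) 1 + e i))]
  have hup : ∀ w, ‖R (Y w)‖ ≤ 2 * ‖w‖ := fun w => (norm_spaMap_le X J k _).trans (hYu w)
  have hne : (Tᶜ).Nonempty := by
    rw [← Finset.card_pos, Finset.card_compl, Fintype.card_fin]
    have := Finset.card_image_le (s := Finset.range k) (f := p)
    rw [Finset.card_range, ← hT] at this
    omega
  obtain ⟨l, hl, hmax⟩ := Finset.exists_max_image Tᶜ (fun l => ‖q l‖) hne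
  have hlT : ∀ i < k, p i ≠ l := (hTmem l).mp (by simpa using hl)
  have hres : ∀ j, spaResidual X J k j = ∑ i, h j i • q i + R (Y (m j)) := by
    intro j
    rw [← spaMap_col, hX, map_add, map_add]
    congr 1
    have : h j = ∑ i, h j i • EuclideanSpace.single i (1 : ℝ) := by
      ext i
      simp [Finset.sum_apply, Pi.single_apply]
    conv_lhs => rw [this]
    simp only [map_sum, map_smul, hq, hR]
  suffices hsel : ∃ i ∉ T, 1 - 320 * δ ≤ h (J k) i by
    obtain ⟨i, hi, hi'⟩ := hsel
    exact ⟨i, (hTmem i).mp hi, hi'⟩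
  refine exists_weight_near_one (h (J k)) (h0 _) (h1 _) q T hδ0 (by linarith)
    (μ := ‖q l‖) ?_ ?_ ?_ ?_ ?_ ?_
  · have := hlow (EuclideanSpace.single l 1) fun i hi => by simp [hlT i hi]
    simpa using this
  · simpa using hup (EuclideanSpace.single l 1)
  · intro i hi
    exact hmax i (by simpa using hi)
  -- The residual of a selected column vanishes, so the residual of its vertex is only the image of
  -- the perturbation `e i`.
  · intro l' hl'
    obtain ⟨i, hi, rfl⟩ := Finset.mem_image.mp hl'
    have hik := Finset.mem_range.mp hi
    have h3 := spaMap_col_eq_zero X J hik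
    rw [hcol, map_add, map_add] at h3
    have : q (p i) = -R (Y (e i)) := eq_neg_of_add_eq_zero_left h3
    rw [this, norm_neg]
    linarith [hup (e i), he i hik]
  -- The selected residual is at least as long as that of a pure column at `l`. Removing the noise
  -- from each of the two columns costs `2 * δ`, hence `4 * δ` in total.
  · obtain ⟨j, hj⟩ := hpure l
    have h3 : spaResidual X J k j = q l + R (Y (m j)) := by
      rw [← spaMap_col, hX, map_add, map_add, hj]
    have h4 := hJ j
    rw [h3, hres (J k)] at h4
    have h5 := norm_add_le (∑ i, h (J k) i • q i) (R (Y (m (J k))))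
    have h6 := norm_sub_le (q l + R (Y (m j))) (R (Y (m j)))
    rw [add_sub_cancel_right] at h6
    linarith [hup (m j), hup (m (J k)), hm j, hm (J k)]
  · intro i hi i' hi' hii
    rw [hTmem] at hi hi'
    have h3 := hlow (EuclideanSpace.single i 1 - EuclideanSpace.single i' 1) fun j hj => by
      simp [hi j hj, hi' j hj]
    rw [map_sub, map_sub] at h3
    have h4 : ‖EuclideanSpace.single i (1 : ℝ) - EuclideanSpace.single i' 1‖ ^ 2 = 2 := by
      rw [norm_sub_sq_real, EuclideanSpace.inner_single_left]
      simp [hii]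
      norm_num
    have h5 := pow_le_pow_left₀ (by positivity) h3 2
    rw [div_pow, h4] at h5
    simp only [hq]
    linarith

/-- Robustness of the successive projection algorithm on a well conditioned near-separable
matrix: the selected columns are close to distinct vertices. -/
theorem spa_near_vertices {d n : ℕ}
    (Y : EuclideanSpace ℝ (Fin K) →ₗ[ℝ] EuclideanSpace ℝ (Fin d))
    (hYl : ∀ v, ‖v‖ / 2 ≤ ‖Y v‖) (hYu : ∀ v, ‖Y v‖ ≤ 2 * ‖v‖)
    (h m : Fin n → EuclideanSpace ℝ (Fin K)) (h0 : ∀ j l, 0 ≤ h j l) (h1 : ∀ j, ∑ l, h j l = 1)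
    (hpure : ∀ l, ∃ j, h j = EuclideanSpace.single l 1) {δ : ℝ} (hδ0 : 0 ≤ δ)
    (hm : ∀ j, ‖m j‖ ≤ δ) (hδ : √K * δ ≤ 1 / 30000) (X : Matrix (Fin d) (Fin n) ℝ)
    (hX : ∀ j, WithLp.toLp 2 (Xᵀ j) = Y (h j + m j)) (J : Fin K → Fin n) (hJ : IsSPAOutput X J) :
    ∃ p : Fin K → Fin K, Function.Injective p ∧ ∀ i, 1 - 320 * δ ≤ h (J i) (p i) := by
  obtain ⟨J', hJJ, hJ'⟩ := hJ
  rcases Nat.eq_zero_or_pos K with rfl | hK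
  · exact ⟨id, Function.injective_id, fun i => i.elim0⟩
  have hK1 : 1 ≤ √(K : ℝ) := by
    rw [Real.one_le_sqrt]; exact_mod_cast (by omega : 1 ≤ K)
  have hδ1 : δ ≤ 1 / 30000 := by nlinarith
  -- Distinctness of the vertices is encoded by weights: vertex `l` has weight below 1/2 in all
  -- earlier selected columns, so it is none of theirs. The induction therefore need not carry a
  -- choice of vertices.
  have key : ∀ k < K, ∃ l, 1 - 320 * δ ≤ h (J' k) l ∧ ∀ i < k, h (J' i) l < 1 / 2 := by
    intro k
    induction k using Nat.strong_induction_on with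
    | _ k ih =>
      intro hk
      have hex : ∀ i, ∃ l : Fin K, i < k →
          1 - 320 * δ ≤ h (J' i) l ∧ ∀ i' < i, h (J' i') l < 1 / 2 := by
        intro i
        by_cases hi : i < k
        · obtain ⟨l, hl⟩ := ih i hi (hi.trans hk)
          exact ⟨l, fun _ => hl⟩
        · exact ⟨⟨0, hK⟩, fun h => absurd h hi⟩
      choose p hp using hex
      have hne : ∀ i < k, ∀ i' < i, p i ≠ p i' := fun i hi i' hi' heq => by
        have h2 := (hp i hi).2 i' hi'
        have h3 := (hp i' (hi'.trans hi)).1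
        rw [heq] at h2
        linarith
      have hinj : Set.InjOn p (Finset.range k) := by
        intro i hi i' hi' heq
        simp only [Finset.coe_range, Set.mem_Iio] at hi hi'
        rcases lt_trichotomy i i' with hlt | rfl | hlt
        · exact absurd heq.symm (hne i' hi' i hlt)
        · rfl
        · exact absurd heq (hne i hi i' hlt)
      obtain ⟨l, hl, hl'⟩ := spa_step Y hYl hYu h m h0 h1 hpure hδ0 hm hδ X hX J' hk
        (hJ' ⟨k, hk⟩) p hinj fun i hi => (hp i hi).1
      refine ⟨l, hl', fun i hi => ?_⟩
      have h2 : h (J' i) (p i) + h (J' i) l ≤ 1 := by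
        rw [← h1 (J' i), ← Finset.sum_pair (hl i hi)]
        exact Finset.sum_le_univ_sum_of_nonneg (h0 _)
      linarith [(hp i hi).1]
  have : Nonempty (Fin K) := ⟨⟨0, hK⟩⟩
  choose! p hp using key
  refine ⟨fun i => p i, fun i i' heq => ?_, fun i => hJJ i ▸ (hp i i.2).1⟩
  have hne : ∀ i i' : Fin K, i' < i → p i ≠ p i' := fun i i' hlt heq => by
    have h2 := (hp i i.2).2 i' hlt
    have h3 := (hp i' i'.2).1
    rw [heq] at h2
    linarith
  rcases lt_trichotomy i i' with hlt | rfl | hlt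
  · exact absurd heq.symm (hne i' i hlt)
  · rfl
  · exact absurd heq (hne i i' hlt)

end SPA

/-! ### Minimum volume ellipsoids: equivariance, John's theorem, uniqueness, existence. -/

section Ellipsoid

open Filter Topology

lemma norm_toLp_sq {ι : Type*} [Fintype ι] (v : ι → ℝ) : ‖WithLp.toLp 2 v‖ ^ 2 = v ⬝ᵥ v := by
  rw [EuclideanSpace.norm_sq_eq]
  simp [dotProduct, pow_two]

lemma abs_dotProduct_le {ι : Type*} [Fintype ι] (v w : ι → ℝ) :
    |v ⬝ᵥ w| ≤ ‖WithLp.toLp 2 v‖ * ‖WithLp.toLp 2 w‖ := by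
  have h := abs_real_inner_le_norm (WithLp.toLp 2 w) (WithLp.toLp 2 v)
  rw [EuclideanSpace.inner_toLp_toLp, mul_comm] at h
  simpa using h

lemma mul_transpose_row {r n d : ℕ} (W : Matrix (Fin d) (Fin r) ℝ) (X : Matrix (Fin r) (Fin n) ℝ)
    (j : Fin n) : (W * X)ᵀ j = W *ᵥ Xᵀ j := by
  ext i
  simp [Matrix.mul_apply, Matrix.mulVec, dotProduct]

open scoped MatrixOrder in
lemma exists_posSemidef_sqrt {ι : Type*} [Fintype ι] [DecidableEq ι] {L : Matrix ι ι ℝ}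
    (hL : L.PosSemidef) : ∃ S : Matrix ι ι ℝ, S.PosSemidef ∧ S * S = L :=
  ⟨CFC.sqrt L, Matrix.nonneg_iff_posSemidef.mp (CFC.sqrt_nonneg L),
    CFC.sqrt_mul_sqrt_self L (Matrix.nonneg_iff_posSemidef.mpr hL)⟩

variable {r n : ℕ}

lemma dotProduct_conj_mulVec {d : ℕ} (W : Matrix (Fin d) (Fin r) ℝ) (L : Matrix (Fin d) (Fin d) ℝ)
    (v w : Fin r → ℝ) : v ⬝ᵥ (Wᵀ * L * W) *ᵥ w = (W *ᵥ v) ⬝ᵥ L *ᵥ (W *ᵥ w) := by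
  rw [← Matrix.mulVec_mulVec, ← Matrix.mulVec_mulVec, Matrix.dotProduct_mulVec,
    Matrix.vecMul_transpose]

lemma IsEnclosingEllipsoid.of_mul {X : Matrix (Fin r) (Fin n) ℝ} {W L : Matrix (Fin r) (Fin r) ℝ}
    (hW : IsUnit W.det) (h : IsEnclosingEllipsoid (W * X) L) :
    IsEnclosingEllipsoid X (Wᵀ * L * W) := by
  refine ⟨?_, fun j => ?_⟩
  · have := h.1.conjTranspose_mul_mul_same (B := W)
      (Matrix.mulVec_injective_of_isUnit ((Matrix.isUnit_iff_isUnit_det _).mpr hW))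
    rwa [Matrix.conjTranspose_eq_transpose_of_trivial] at this
  · rw [dotProduct_conj_mulVec, ← mul_transpose_row]
    exact h.2 j

lemma IsEnclosingEllipsoid.mul {X : Matrix (Fin r) (Fin n) ℝ} {W L : Matrix (Fin r) (Fin r) ℝ}
    (hW : IsUnit W.det) (h : IsEnclosingEllipsoid X L) :
    IsEnclosingEllipsoid (W * X) ((W⁻¹)ᵀ * L * W⁻¹) := by
  refine IsEnclosingEllipsoid.of_mul (Matrix.isUnit_nonsing_inv_det _ hW) ?_
  rwa [← Matrix.mul_assoc, Matrix.nonsing_inv_mul _ hW, Matrix.one_mul]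

/-- Minimum volume ellipsoids are equivariant under linear transformations. -/
lemma IsMinVolEllipsoid.of_mul {X : Matrix (Fin r) (Fin n) ℝ} {W L : Matrix (Fin r) (Fin r) ℝ}
    (hW : IsUnit W.det) (h : IsMinVolEllipsoid (W * X) L) :
    IsMinVolEllipsoid X (Wᵀ * L * W) := by
  refine ⟨h.1.of_mul hW, fun L' hL' => ?_⟩
  have h1 := h.2 _ (hL'.mul hW)
  rw [Matrix.det_mul, Matrix.det_mul, Matrix.det_transpose] at h1 ⊢
  have h2 : W.det * W⁻¹.det = 1 := by
    rw [← Matrix.det_mul, Matrix.mul_nonsing_inv _ hW, Matrix.det_one]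
  have h3 : L'.det = W.det ^ 2 * (W⁻¹.det * L'.det * W⁻¹.det) := by
    calc L'.det = (W.det * W⁻¹.det) ^ 2 * L'.det := by rw [h2]; ring
      _ = _ := by ring
  rw [h3]
  nlinarith [mul_le_mul_of_nonneg_left h1 (sq_nonneg W.det)]

/-- Moves the points so that their ellipsoid is the unit ball, the position in which John's theorem
is stated. -/
lemma IsMinVolEllipsoid.mul_one {X : Matrix (Fin r) (Fin n) ℝ} {Y : Matrix (Fin r) (Fin r) ℝ}
    (hY : IsUnit Y.det) (h : IsMinVolEllipsoid X (Yᵀ * Y)) : IsMinVolEllipsoid (Y * X) 1 := by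
  have h1 : IsMinVolEllipsoid (Y⁻¹ * (Y * X)) (Yᵀ * Y) := by
    rwa [← Matrix.mul_assoc, Matrix.nonsing_inv_mul _ hY, Matrix.one_mul]
  have h2 := h1.of_mul (Matrix.isUnit_nonsing_inv_det _ hY)
  rwa [← Matrix.mul_assoc, ← Matrix.transpose_mul, Matrix.mul_nonsing_inv _ hY,
    Matrix.transpose_one, Matrix.one_mul, Matrix.mul_nonsing_inv _ hY] at h2

lemma abs_dotProduct_mulVec_le (D : Matrix (Fin r) (Fin r) ℝ) (v : Fin r → ℝ) :
    |v ⬝ᵥ D *ᵥ v| ≤ (∑ a, ∑ b, |D a b|) * (v ⬝ᵥ v) := by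
  have hexp : v ⬝ᵥ D *ᵥ v = ∑ a, ∑ b, D a b * (v a * v b) := by
    simp only [dotProduct, Matrix.mulVec, Finset.mul_sum]
    exact Finset.sum_congr rfl fun a _ => Finset.sum_congr rfl fun b _ => by ring
  have hcoord : ∀ a, v a ^ 2 ≤ v ⬝ᵥ v := fun a => by
    rw [dotProduct, pow_two]
    exact Finset.single_le_sum (f := fun a => v a * v a) (fun i _ => mul_self_nonneg _)
      (Finset.mem_univ a)
  rw [hexp, Finset.sum_mul]
  refine (Finset.abs_sum_le_sum_abs _ _).trans (Finset.sum_le_sum fun a _ => ?_)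
  rw [Finset.sum_mul]
  refine (Finset.abs_sum_le_sum_abs _ _).trans (Finset.sum_le_sum fun b _ => ?_)
  rw [abs_mul]
  refine mul_le_mul_of_nonneg_left ?_ (abs_nonneg _)
  rw [abs_le]
  constructor <;> nlinarith [hcoord a, hcoord b, sq_nonneg (v a - v b), sq_nonneg (v a + v b)]

/-- The ball is not a minimum volume ellipsoid if some symmetric direction increases the volume and
keeps the points inside. -/
lemma not_isMinVolEllipsoid_one {X : Matrix (Fin r) (Fin n) ℝ} (D : Matrix (Fin r) (Fin r) ℝ)
    (hD : D.IsSymm) (htr : 0 < D.trace) (u : ℝ)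
    (hu : ∀ j, Xᵀ j ⬝ᵥ D *ᵥ Xᵀ j ≤ u * (1 - Xᵀ j ⬝ᵥ Xᵀ j)) : ¬ IsMinVolEllipsoid X 1 := by
  intro h
  -- `g` is the remainder in `det (1 + t D) = 1 + t * D.trace + t ^ 2 * g t`. For small positive `t`
  -- the trace term dominates and the determinant exceeds 1.
  set g : ℝ → ℝ := fun t =>
    (Matrix.det (1 + (Polynomial.X : Polynomial ℝ) • D.map Polynomial.C)).divX.divX.eval t with hg
  have hgc : Continuous g := Polynomial.continuous _
  set c := ∑ a, ∑ b, |D a b| with hc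
  have e1 : ∀ᶠ t in 𝓝[>] (0 : ℝ), 0 < D.trace + g t * t := by
    have : Tendsto (fun t => D.trace + g t * t) (𝓝 0) (𝓝 (D.trace + g 0 * 0)) :=
      ((continuous_const.add (hgc.mul continuous_id)).tendsto 0)
    rw [mul_zero, add_zero] at this
    exact (this.eventually (lt_mem_nhds htr)).filter_mono nhdsWithin_le_nhds
  have e2 : ∀ᶠ t in 𝓝[>] (0 : ℝ), t * u < 1 := by
    have : Tendsto (fun t : ℝ => t * u) (𝓝 0) (𝓝 (0 * u)) := (continuous_mul_const u).tendsto 0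
    rw [zero_mul] at this
    exact (this.eventually (gt_mem_nhds one_pos)).filter_mono nhdsWithin_le_nhds
  have e3 : ∀ᶠ t in 𝓝[>] (0 : ℝ), t * c < 1 := by
    have : Tendsto (fun t : ℝ => t * c) (𝓝 0) (𝓝 (0 * c)) := (continuous_mul_const c).tendsto 0
    rw [zero_mul] at this
    exact (this.eventually (gt_mem_nhds one_pos)).filter_mono nhdsWithin_le_nhds
  obtain ⟨t, ⟨⟨h1, h2⟩, h3⟩, ht⟩ := (((e1.and e2).and e3).and self_mem_nhdsWithin).exists
  replace ht : 0 < t := ht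
  have hquad : ∀ v : Fin r → ℝ, v ⬝ᵥ (1 + t • D) *ᵥ v = v ⬝ᵥ v + t * (v ⬝ᵥ D *ᵥ v) := fun v => by
    rw [Matrix.add_mulVec, Matrix.one_mulVec, Matrix.smul_mulVec, dotProduct_add,
      dotProduct_smul, smul_eq_mul]
  have hencl : IsEnclosingEllipsoid X (1 + t • D) := by
    refine ⟨Matrix.PosDef.of_dotProduct_mulVec_pos ?_ fun v hv => ?_, fun j => ?_⟩
    · rw [Matrix.IsHermitian, Matrix.conjTranspose_eq_transpose_of_trivial, Matrix.transpose_add,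
        Matrix.transpose_one, Matrix.transpose_smul, hD]
    · rw [star_trivial, hquad]
      have hv0 : 0 < v ⬝ᵥ v := by
        rw [← norm_toLp_sq]
        have : WithLp.toLp 2 v ≠ 0 := by simpa using hv
        positivity
      have h5 := abs_le.mp (abs_dotProduct_mulVec_le D v)
      rw [← hc] at h5
      nlinarith [mul_le_mul_of_nonneg_left h5.1 ht.le, mul_lt_mul_of_pos_right h3 hv0]
    -- The quadratic form exceeds `x ⬝ᵥ x` by at most `t * u * (1 - x ⬝ᵥ x)`. Both `t * u < 1` and
    -- `x ⬝ᵥ x ≤ 1` hold, so the value stays at most 1.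
    · rw [hquad]
      have h5 := h.1.2 j
      rw [Matrix.one_mulVec] at h5
      nlinarith [mul_le_mul_of_nonneg_left (hu j) ht.le]
  have h5 := h.2 _ hencl
  rw [Matrix.det_one, Matrix.det_one_add_smul] at h5
  change 1 + D.trace * t + g t * t ^ 2 ≤ 1 at h5
  nlinarith [mul_pos ht h1]

/-- John's theorem: the contact points of a minimum volume ellipsoid, normalised to be the unit
ball, carry a decomposition of the identity. -/
theorem IsMinVolEllipsoid.exists_weights (hr : 0 < r) {X : Matrix (Fin r) (Fin n) ℝ}
    (h : IsMinVolEllipsoid X 1) :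
    ∃ u : Fin n → ℝ, (∀ j, 0 ≤ u j) ∧ ∑ j, u j = r ∧
      ∀ a b, ∑ j, u j * (X a j * X b j) = (1 : Matrix (Fin r) (Fin r) ℝ) a b := by
  have hr' : (r : ℝ) ≠ 0 := by exact_mod_cast hr.ne'
  let P : Fin n → (Fin r × Fin r → ℝ) := fun j ab => X ab.1 j * X ab.2 j
  let I : Fin r × Fin r → ℝ := fun ab => (r : ℝ)⁻¹ * (1 : Matrix (Fin r) (Fin r) ℝ) ab.1 ab.2
  -- Weights exist exactly when the normalised identity is a convex combination of the matrices `x_j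
  -- x_jᵀ`. Otherwise a separating functional yields a direction in which the ball can be improved.
  by_cases hI : I ∈ convexHull ℝ (Set.range P)
  · rw [convexHull_range_eq_exists_affineCombination] at hI
    obtain ⟨s, w, hw0, hw1, hw⟩ := hI
    rw [Finset.affineCombination_eq_linear_combination _ _ _ hw1] at hw
    refine ⟨fun j => if j ∈ s then r * w j else 0, fun j => ?_, ?_, fun a b => ?_⟩
    · dsimp only
      split_ifs with hj
      · exact mul_nonneg (Nat.cast_nonneg _) (hw0 j hj)
      · exact le_rfl
    · rw [Finset.sum_ite_mem, Finset.univ_inter, ← Finset.mul_sum, hw1, _root_.mul_one]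
    · have h1 := congrFun hw (a, b)
      simp only [Finset.sum_apply, Pi.smul_apply, smul_eq_mul, I, P] at h1
      simp only [ite_mul, zero_mul]
      rw [Finset.sum_ite_mem, Finset.univ_inter]
      simp_rw [mul_assoc]
      rw [← Finset.mul_sum, h1, mul_inv_cancel_left₀ hr']
  · exfalso
    obtain ⟨f, u, hf, hu⟩ := geometric_hahn_banach_closed_point (convex_convexHull ℝ (Set.range P))
      ((Set.finite_range P).isClosed_convexHull ℝ) hI
    let D₀ : Matrix (Fin r) (Fin r) ℝ := fun a b => f (Pi.single (a, b) 1)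
    have hfsum : ∀ x : Fin r × Fin r → ℝ, f x = ∑ a, ∑ b, x (a, b) * D₀ a b := by
      intro x
      rw [← Fintype.sum_prod_type' (f := fun a b => x (a, b) * D₀ a b)]
      conv_lhs => rw [pi_eq_sum_univ' x]
      simp [D₀, map_sum]
    -- Symmetrising the functional changes no value on the `x_j x_jᵀ`. Subtracting `u • 1` turns
    -- separation from the identity into positive trace, and the bound on the points into the
    -- required inequality.
    refine not_isMinVolEllipsoid_one ((1 / 2 : ℝ) • (D₀ + D₀ᵀ) - u • 1) ?_ ?_ u (fun j => ?_) h
    · simp [Matrix.IsSymm, add_comm]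
    · have h1 : f I = (r : ℝ)⁻¹ * D₀.trace := by
        rw [hfsum, Matrix.trace, Finset.mul_sum]
        refine Finset.sum_congr rfl fun a _ => ?_
        rw [Finset.sum_eq_single a]
        · simp [I]
        · intro b _ hb
          simp [I, Matrix.one_apply, hb.symm]
        · simp
      rw [h1] at hu
      rw [Matrix.trace_sub, Matrix.trace_smul, Matrix.trace_add, Matrix.trace_transpose,
        Matrix.trace_smul, Matrix.trace_one, Fintype.card_fin, smul_eq_mul, smul_eq_mul]
      have h2 : (0 : ℝ) < r := by exact_mod_cast hr
      have h3 := mul_lt_mul_of_pos_left hu h2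
      rw [mul_inv_cancel_left₀ hr'] at h3
      linarith
    · have h1 := hf (P j) (subset_convexHull ℝ _ ⟨j, rfl⟩)
      have h2 : f (P j) = Xᵀ j ⬝ᵥ D₀ *ᵥ Xᵀ j := by
        rw [hfsum]
        simp only [dotProduct, Matrix.mulVec, Finset.mul_sum, P, Matrix.transpose_apply]
        exact Finset.sum_congr rfl fun a _ => Finset.sum_congr rfl fun b _ => by ring
      have h3 : Xᵀ j ⬝ᵥ D₀ᵀ *ᵥ Xᵀ j = Xᵀ j ⬝ᵥ D₀ *ᵥ Xᵀ j := by
        rw [Matrix.dotProduct_mulVec, Matrix.vecMul_transpose, dotProduct_comm]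
      rw [Matrix.sub_mulVec, Matrix.smul_mulVec, Matrix.smul_mulVec, Matrix.add_mulVec,
        Matrix.one_mulVec, dotProduct_sub, dotProduct_smul, dotProduct_smul, dotProduct_add, h3,
        smul_eq_mul, smul_eq_mul, ← h2]
      linarith

/-- The decomposition `∑ u_j x_j x_jᵀ = 1` is paired with `G` in the trace inner product. -/
lemma sum_weights_dotProduct {X : Matrix (Fin r) (Fin n) ℝ} {u : Fin n → ℝ}
    (hu : ∀ a b, ∑ j, u j * (X a j * X b j) = (1 : Matrix (Fin r) (Fin r) ℝ) a b)
    (G : Matrix (Fin r) (Fin r) ℝ) : ∑ j, u j * (Xᵀ j ⬝ᵥ G *ᵥ Xᵀ j) = G.trace := by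
  have h1 : ∀ j, u j * (Xᵀ j ⬝ᵥ G *ᵥ Xᵀ j) =
      ∑ a, ∑ b, G a b * (u j * (X a j * X b j)) := fun j => by
    simp only [dotProduct, Matrix.mulVec, Finset.mul_sum, Matrix.transpose_apply]
    exact Finset.sum_congr rfl fun a _ => Finset.sum_congr rfl fun b _ => by ring
  simp_rw [h1]
  rw [Finset.sum_comm]
  refine Finset.sum_congr rfl fun a _ => ?_
  rw [Finset.sum_comm]
  simp_rw [← Finset.mul_sum, hu, Matrix.one_apply]
  simp

lemma sum_weights_dotProduct_sq {X : Matrix (Fin r) (Fin n) ℝ} {u : Fin n → ℝ}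
    (hu : ∀ a b, ∑ j, u j * (X a j * X b j) = (1 : Matrix (Fin r) (Fin r) ℝ) a b)
    (v : Fin r → ℝ) : ∑ j, u j * (v ⬝ᵥ Xᵀ j) ^ 2 = ‖WithLp.toLp 2 v‖ ^ 2 := by
  have h1 := sum_weights_dotProduct hu (Matrix.vecMulVec v v)
  rw [Matrix.trace_vecMulVec, ← norm_toLp_sq] at h1
  rw [← h1]
  refine Finset.sum_congr rfl fun j _ => ?_
  rw [Matrix.vecMulVec_mulVec, dotProduct_smul, dotProduct_comm (Xᵀ j) v]
  simp [pow_two]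

/-- The equality case of AM–GM for the eigenvalues, from `log x ≤ x - 1` with equality only at 1. -/
lemma eq_one_of_trace_le_of_one_le_det {G : Matrix (Fin r) (Fin r) ℝ} (hG : G.PosDef)
    (htr : G.trace ≤ r) (hdet : 1 ≤ G.det) : G = 1 := by
  have hpos := hG.eigenvalues_pos
  have h1 : ∑ i, hG.1.eigenvalues i ≤ r := by
    have := hG.1.trace_eq_sum_eigenvalues
    simp only [RCLike.ofReal_real_eq_id, id] at this
    rwa [this] at htr
  have h2 : 0 ≤ ∑ i, Real.log (hG.1.eigenvalues i) := by
    have := hG.1.det_eq_prod_eigenvalues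
    simp only [RCLike.ofReal_real_eq_id, id] at this
    rw [← Real.log_prod fun i _ => (hpos i).ne', ← this]
    exact Real.log_nonneg hdet
  have h3 : ∀ i, hG.1.eigenvalues i = 1 := by
    by_contra! hcon
    obtain ⟨i, hi⟩ := hcon
    have : ∑ i, Real.log (hG.1.eigenvalues i) < ∑ i, (hG.1.eigenvalues i - 1) :=
      Finset.sum_lt_sum (fun i _ => Real.log_le_sub_one_of_pos (hpos i))
        ⟨i, Finset.mem_univ i, Real.log_lt_sub_one_of_pos (hpos i) hi⟩
    rw [Finset.sum_sub_distrib] at this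
    simp at this
    linarith
  rw [hG.1.spectral_theorem]
  have h4 : (RCLike.ofReal ∘ hG.1.eigenvalues : Fin r → ℝ) = fun _ => 1 := by
    funext i; simp [h3 i]
  rw [h4, Matrix.diagonal_one, map_one]

/-- The minimum volume ellipsoid is unique. -/
theorem IsMinVolEllipsoid.eq_of_det_le (hr : 0 < r) {X : Matrix (Fin r) (Fin n) ℝ}
    {Y L : Matrix (Fin r) (Fin r) ℝ} (h : IsMinVolEllipsoid X (Yᵀ * Y))
    (hL : IsEnclosingEllipsoid X L) (hdet : (Yᵀ * Y).det ≤ L.det) : L = Yᵀ * Y := by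
  have hYdet : 0 < Y.det ^ 2 := by
    have := h.1.1.det_pos
    rwa [Matrix.det_mul, Matrix.det_transpose, ← pow_two] at this
  have hY : IsUnit Y.det := by
    rw [isUnit_iff_ne_zero]
    rintro h0
    simp [h0] at hYdet
  obtain ⟨u, hu0, hu1, hu⟩ := (h.mul_one hY).exists_weights hr
  have hG := hL.mul hY
  -- In the normalised position, averaging the enclosure inequalities with John's weights bounds the
  -- trace by `r`, while the determinant is at least 1.
  have h1 : (Y⁻¹ᵀ * L * Y⁻¹) = 1 := by
    refine eq_one_of_trace_le_of_one_le_det hG.1 ?_ ?_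
    · rw [← sum_weights_dotProduct hu, ← hu1]
      exact Finset.sum_le_sum fun j _ => mul_le_of_le_one_right (hu0 j) (hG.2 j)
    · rw [Matrix.det_mul, Matrix.det_transpose] at hdet
      rw [Matrix.det_mul, Matrix.det_mul, Matrix.det_transpose, Matrix.det_nonsing_inv,
        Ring.inverse_eq_inv', mul_comm, ← mul_assoc, ← pow_two, inv_pow, inv_mul_eq_div,
        one_le_div hYdet]
      linarith
  have h2 : Yᵀ * (Y⁻¹ᵀ * L * Y⁻¹) * Y = L := by
    rw [Matrix.mul_assoc, Matrix.mul_assoc, Matrix.nonsing_inv_mul _ hY, Matrix.mul_one,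
      ← Matrix.mul_assoc, ← Matrix.transpose_mul, Matrix.nonsing_inv_mul _ hY,
      Matrix.transpose_one, Matrix.one_mul]
  rw [← h2, h1, Matrix.mul_one]

/-- Points which span the space have a minimum volume ellipsoid. -/
theorem exists_isMinVolEllipsoid (X : Matrix (Fin r) (Fin n) ℝ) (R : Matrix (Fin n) (Fin r) ℝ)
    (hR : X * R = 1) : ∃ Y : Matrix (Fin r) (Fin r) ℝ, IsMinVolEllipsoid X (Yᵀ * Y) := by
  let S : Set (Matrix (Fin r) (Fin r) ℝ) := {L | L.PosSemidef ∧ ∀ j, Xᵀ j ⬝ᵥ L *ᵥ Xᵀ j ≤ 1}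
  have hquadc : ∀ v : Fin r → ℝ, Continuous fun L : Matrix (Fin r) (Fin r) ℝ => v ⬝ᵥ L *ᵥ v :=
    fun v => continuous_const.dotProduct (continuous_id.matrix_mulVec continuous_const)
  have hclosed : IsClosed S := by
    have hS : S = {L | Lᴴ = L} ∩ (⋂ v : Fin r → ℝ, {L | 0 ≤ v ⬝ᵥ L *ᵥ v}) ∩
        ⋂ j, {L | Xᵀ j ⬝ᵥ L *ᵥ Xᵀ j ≤ 1} := by
      ext L
      simp [S, Matrix.posSemidef_iff_dotProduct_mulVec, Matrix.IsHermitian]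
    rw [hS]
    refine ((isClosed_eq continuous_id.matrix_conjTranspose continuous_id).inter
      (isClosed_iInter fun v => ?_)).inter (isClosed_iInter fun j => ?_)
    · exact isClosed_le continuous_const (hquadc v)
    · exact isClosed_le (hquadc _) continuous_const
  -- Boundedness: the entries of `Xᵀ * L * X` lie in `[-1, 1]` by polarisation, and `L` is recovered
  -- from them through the right inverse `R`.
  have hsub : S ⊆ (fun N : Matrix (Fin n) (Fin n) ℝ => Rᵀ * N * R) ''
      (Set.univ.pi fun _ => Set.univ.pi fun _ => Set.Icc (-1 : ℝ) 1) := by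
    rintro L ⟨hL, hLj⟩
    refine ⟨Xᵀ * L * X, ?_, ?_⟩
    · have hentry : ∀ i j, (Xᵀ * L * X) i j = Xᵀ i ⬝ᵥ L *ᵥ Xᵀ j := fun i j => by
        rw [Matrix.mul_assoc, Matrix.mul_apply]
        simp [dotProduct, ← mul_transpose_row]
      have hsymm : ∀ v w : Fin r → ℝ, v ⬝ᵥ L *ᵥ w = w ⬝ᵥ L *ᵥ v := fun v w => by
        have h1 := hL.1
        rw [Matrix.IsHermitian, Matrix.conjTranspose_eq_transpose_of_trivial] at h1
        rw [Matrix.dotProduct_mulVec, ← Matrix.mulVec_transpose, h1, dotProduct_comm]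
      have hnn : ∀ v : Fin r → ℝ, 0 ≤ v ⬝ᵥ L *ᵥ v := fun v => by
        simpa using hL.dotProduct_mulVec_nonneg v
      intro i _ j _
      rw [hentry]
      have h1 := hnn (Xᵀ i + Xᵀ j)
      have h2 := hnn (Xᵀ i - Xᵀ j)
      simp only [Matrix.mulVec_add, Matrix.mulVec_sub, add_dotProduct, sub_dotProduct,
        dotProduct_add, dotProduct_sub] at h1 h2
      rw [hsymm (Xᵀ j) (Xᵀ i)] at h1 h2
      constructor <;> linarith [hLj i, hLj j]
    · calc Rᵀ * (Xᵀ * L * X) * R = (Rᵀ * Xᵀ) * L * (X * R) := by simp only [Matrix.mul_assoc]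
        _ = L := by
          rw [← Matrix.transpose_mul, hR, Matrix.transpose_one, Matrix.one_mul, Matrix.mul_one]
  have hcomp : IsCompact S := by
    refine IsCompact.of_isClosed_subset (IsCompact.image ?_ ?_) hclosed hsub
    · exact isCompact_univ_pi fun _ => isCompact_univ_pi fun _ => isCompact_Icc
    · exact (continuous_const.matrix_mul continuous_id).matrix_mul continuous_const
  obtain ⟨c, hc0, hc⟩ : ∃ c : ℝ, 0 < c ∧ ∀ j, c * (Xᵀ j ⬝ᵥ Xᵀ j) ≤ 1 := by
    refine ⟨(1 + ∑ j, Xᵀ j ⬝ᵥ Xᵀ j)⁻¹, ?_, fun j => ?_⟩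
    · have : 0 ≤ ∑ j, Xᵀ j ⬝ᵥ Xᵀ j := Finset.sum_nonneg fun j _ => by
        rw [← norm_toLp_sq]; positivity
      positivity
    · have h1 : Xᵀ j ⬝ᵥ Xᵀ j ≤ ∑ j, Xᵀ j ⬝ᵥ Xᵀ j :=
        Finset.single_le_sum (f := fun j => Xᵀ j ⬝ᵥ Xᵀ j)
          (fun j _ => by rw [← norm_toLp_sq]; positivity) (Finset.mem_univ j)
      have h2 : 0 ≤ Xᵀ j ⬝ᵥ Xᵀ j := by rw [← norm_toLp_sq]; positivity
      rw [inv_mul_le_one₀ (by linarith)]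
      linarith
  have hcS : c • (1 : Matrix (Fin r) (Fin r) ℝ) ∈ S := by
    refine ⟨Matrix.PosSemidef.one.smul hc0.le, fun j => ?_⟩
    rw [Matrix.smul_mulVec, Matrix.one_mulVec, dotProduct_smul]
    exact hc j
  obtain ⟨L, hLS, hmax⟩ := hcomp.exists_isMaxOn ⟨_, hcS⟩
    (continuous_id.matrix_det : Continuous fun L : Matrix (Fin r) (Fin r) ℝ => L.det).continuousOn
  have hdet : 0 < L.det := lt_of_lt_of_le (by simp [hc0]) (hmax hcS)
  have hpd : L.PosDef := by
    rw [hLS.1.posDef_iff_isUnit, Matrix.isUnit_iff_isUnit_det]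
    exact hdet.ne'.isUnit
  obtain ⟨Y, hY, hYY⟩ := exists_posSemidef_sqrt hLS.1
  have hYt : Yᵀ = Y := by
    rw [← Matrix.conjTranspose_eq_transpose_of_trivial]
    exact hY.1
  rw [← hYY] at hpd hmax hLS
  refine ⟨Y, ?_⟩
  rw [hYt]
  exact ⟨⟨hpd, hLS.2⟩, fun L' hL' => hmax ⟨hL'.1.posSemidef, hL'.2⟩⟩

end Ellipsoid

/-! ### Conditioning of the ellipsoid when every point is near a basis vector. -/

section Conditioning

variable {r n : ℕ}

lemma norm_transpose_mulVec_le {m d : ℕ} {M : Matrix (Fin m) (Fin d) ℝ} {c : ℝ} (hc : 0 ≤ c)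
    (h : ∀ v, ‖WithLp.toLp 2 (M *ᵥ v)‖ ≤ c * ‖WithLp.toLp 2 v‖) (w : Fin m → ℝ) :
    ‖WithLp.toLp 2 (Mᵀ *ᵥ w)‖ ≤ c * ‖WithLp.toLp 2 w‖ := by
  rcases (norm_nonneg (WithLp.toLp 2 (Mᵀ *ᵥ w))).eq_or_lt with h0 | h0
  · rw [← h0]
    positivity
  · have h1 : ‖WithLp.toLp 2 (Mᵀ *ᵥ w)‖ ^ 2 ≤
        c * ‖WithLp.toLp 2 (Mᵀ *ᵥ w)‖ * ‖WithLp.toLp 2 w‖ := by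
      rw [norm_toLp_sq, Matrix.dotProduct_mulVec, Matrix.vecMul_transpose]
      refine (le_abs_self _).trans ((abs_dotProduct_le _ _).trans ?_)
      exact mul_le_mul_of_nonneg_right (h _) (norm_nonneg _)
    nlinarith

/-- The minimum volume ellipsoid of small perturbations of the basis vectors, each possibly
repeated, is well conditioned. -/
theorem IsMinVolEllipsoid.conditioning_of_near_basis (hr : 0 < r) {X : Matrix (Fin r) (Fin n) ℝ}
    {Y : Matrix (Fin r) (Fin r) ℝ} (h : IsMinVolEllipsoid X (Yᵀ * Y)) (κ : Fin n → Fin r)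
    (hκ : Function.Surjective κ) {δ : ℝ} (hδ0 : 0 ≤ δ)
    (hm : ∀ j, ‖WithLp.toLp 2 (Xᵀ j - Pi.single (κ j) 1)‖ ≤ δ) (hδ : √r * δ ≤ 1 / 10) :
    (∀ v, ‖WithLp.toLp 2 v‖ / 2 ≤ ‖WithLp.toLp 2 (Y *ᵥ v)‖) ∧
      ∀ v, ‖WithLp.toLp 2 (Y *ᵥ v)‖ ≤ 2 * ‖WithLp.toLp 2 v‖ := by
  have hr1 : 1 ≤ √(r : ℝ) := by
    rw [Real.one_le_sqrt]; exact_mod_cast (by omega : 1 ≤ r)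
  have hδ1 : δ ≤ 1 / 10 := by nlinarith
  have hY : IsUnit Y.det := by
    have := h.1.1.det_pos
    rw [Matrix.det_mul, Matrix.det_transpose] at this
    rw [isUnit_iff_ne_zero]
    rintro h0
    simp [h0] at this
  obtain ⟨u, hu0, hu1, hu⟩ := (h.mul_one hY).exists_weights hr
  set Z := (Y⁻¹)ᵀ with hZ
  have hZY : ∀ w v, (Z *ᵥ w) ⬝ᵥ (Y *ᵥ v) = w ⬝ᵥ v := fun w v => by
    rw [hZ, Matrix.dotProduct_mulVec, ← Matrix.mulVec_transpose, Matrix.mulVec_mulVec,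
      ← Matrix.transpose_mul, Matrix.nonsing_inv_mul _ hY, Matrix.transpose_one, Matrix.one_mulVec]
  have hZYt : ∀ w, Z *ᵥ (Yᵀ *ᵥ w) = w := fun w => by
    rw [Matrix.mulVec_mulVec, hZ, ← Matrix.transpose_mul, Matrix.mul_nonsing_inv _ hY,
      Matrix.transpose_one, Matrix.one_mulVec]
  set m : Fin n → Fin r → ℝ := fun j => Xᵀ j - Pi.single (κ j) 1 with hmdef
  have hx : ∀ j w, w ⬝ᵥ Xᵀ j = w (κ j) + w ⬝ᵥ m j := fun j w => by
    rw [hmdef, dotProduct_sub, dotProduct_single_one]; ring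
  have hwm : ∀ w j, |w ⬝ᵥ m j| ≤ ‖WithLp.toLp 2 w‖ * δ := fun w j =>
    (abs_dotProduct_le _ _).trans (mul_le_mul_of_nonneg_left (hm j) (norm_nonneg _))
  -- By John's decomposition `‖Z w‖ ^ 2 = ∑ u_j (w ⬝ x_j) ^ 2`, so `t w` has the norm of `Z w`. It
  -- splits into a main part `p`, diagonal with entries the cluster weights `a k`, and an error `e`.
  -- Two-sided bounds on `a` therefore control `Z`, hence `Y`.
  let t : (Fin r → ℝ) → EuclideanSpace ℝ (Fin n) := fun w =>
    WithLp.toLp 2 fun j => √(u j) * (w ⬝ᵥ Xᵀ j)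
  let p : (Fin r → ℝ) → EuclideanSpace ℝ (Fin n) := fun w =>
    WithLp.toLp 2 fun j => √(u j) * w (κ j)
  let e : (Fin r → ℝ) → EuclideanSpace ℝ (Fin n) := fun w =>
    WithLp.toLp 2 fun j => √(u j) * (w ⬝ᵥ m j)
  have hsq : ∀ f : Fin n → ℝ, ‖WithLp.toLp 2 (fun j => √(u j) * f j)‖ ^ 2 =
      ∑ j, u j * f j ^ 2 := fun f => by
    rw [norm_toLp_sq, dotProduct]
    refine Finset.sum_congr rfl fun j _ => ?_
    rw [mul_mul_mul_comm, Real.mul_self_sqrt (hu0 j), pow_two]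
  have htpe : ∀ w, t w = p w + e w := fun w => by
    ext j
    simp only [t, p, e, PiLp.add_apply, hx]
    ring
  have ht : ∀ w, ‖t w‖ = ‖WithLp.toLp 2 (Z *ᵥ w)‖ := fun w => by
    rw [← sq_eq_sq₀ (norm_nonneg _) (norm_nonneg _), hsq, ← sum_weights_dotProduct_sq hu]
    refine Finset.sum_congr rfl fun j _ => ?_
    rw [mul_transpose_row, hZY]
  have he : ∀ w, ‖e w‖ ≤ 1 / 10 * ‖WithLp.toLp 2 w‖ := fun w => by
    have h1 : ‖e w‖ ≤ √r * δ * ‖WithLp.toLp 2 w‖ := by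
      refine abs_le_of_sq_le_sq' ?_ (by positivity) |>.2
      rw [hsq, mul_pow, mul_pow, Real.sq_sqrt (Nat.cast_nonneg _), ← hu1, mul_assoc, Finset.sum_mul]
      refine Finset.sum_le_sum fun j _ => mul_le_mul_of_nonneg_left ?_ (hu0 j)
      rw [← sq_abs, ← mul_pow]
      exact pow_le_pow_left₀ (abs_nonneg _) ((hwm w j).trans (by rw [mul_comm])) 2
    exact h1.trans (mul_le_mul_of_nonneg_right hδ (norm_nonneg _))
  set a : Fin r → ℝ := fun k => ∑ j with κ j = k, u j with ha
  have hp : ∀ w, ‖p w‖ ^ 2 = ∑ k, a k * w k ^ 2 := fun w => by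
    rw [hsq, ← Finset.sum_fiberwise _ κ]
    refine Finset.sum_congr rfl fun k _ => ?_
    rw [ha, Finset.sum_mul]
    refine Finset.sum_congr rfl fun j hj => ?_
    rw [(Finset.mem_filter.mp hj).2]
  have ha0 : ∀ k, 0 ≤ a k := fun k => Finset.sum_nonneg fun j _ => hu0 j
  have hwsq : ∀ w : Fin r → ℝ, ‖WithLp.toLp 2 w‖ ^ 2 = ∑ k, w k ^ 2 := fun w => by
    rw [norm_toLp_sq, dotProduct]
    simp_rw [pow_two]
  have hcol : ∀ j, ‖WithLp.toLp 2 (Y *ᵥ Xᵀ j)‖ ≤ 1 := fun j => by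
    have h1 := (h.mul_one hY).1.2 j
    rw [Matrix.one_mulVec, mul_transpose_row, ← norm_toLp_sq] at h1
    exact (sq_le_one_iff₀ (norm_nonneg _)).mp h1
  -- Testing `Z` on a basis vector against a point `x_j` of its cluster: `9/10 ≤ w ⬝ x_j ≤ ‖Z w‖ ≤
  -- √(a k) + 1/10`, because `Y x_j` lies in the unit ball.
  have halow : ∀ k, (4 / 5) ^ 2 ≤ a k := fun k => by
    obtain ⟨j, rfl⟩ := hκ k
    set w : Fin r → ℝ := Pi.single (κ j) 1 with hw
    have hwn : ‖WithLp.toLp 2 w‖ = 1 := by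
      rw [← sq_eq_sq₀ (norm_nonneg _) zero_le_one, norm_toLp_sq, hw, dotProduct_single_one]
      simp
    have hpn : ‖p w‖ ^ 2 = a (κ j) := by
      rw [hp, Finset.sum_eq_single (κ j)]
      · simp [hw]
      · intro k _ hk
        simp [hw, hk]
      · simp
    have h1 : 9 / 10 ≤ w ⬝ᵥ Xᵀ j := by
      have h2 := (abs_le.mp (hwm w j)).1
      rw [hx, hw, Pi.single_eq_same, ← hw]
      rw [hwn] at h2
      linarith
    have h2 : w ⬝ᵥ Xᵀ j ≤ ‖t w‖ := by
      rw [← hZY, ht]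
      refine (le_abs_self _).trans ((abs_dotProduct_le _ _).trans ?_)
      exact mul_le_of_le_one_right (norm_nonneg _) (hcol j)
    have h3 := norm_add_le (p w) (e w)
    rw [← htpe] at h3
    have h4 := he w
    rw [hwn] at h4
    rw [← hpn]
    exact pow_le_pow_left₀ (by norm_num) (by linarith) 2
  have hYu : ∀ v, ‖WithLp.toLp 2 (Y *ᵥ v)‖ ≤ 2 * ‖WithLp.toLp 2 v‖ := by
    have hZl : ∀ w, ‖WithLp.toLp 2 w‖ ≤ 2 * ‖WithLp.toLp 2 (Z *ᵥ w)‖ := fun w => by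
      have h1 : 4 / 5 * ‖WithLp.toLp 2 w‖ ≤ ‖p w‖ := by
        refine abs_le_of_sq_le_sq' ?_ (norm_nonneg _) |>.2
        rw [mul_pow, hp, hwsq, Finset.mul_sum]
        exact Finset.sum_le_sum fun k _ => mul_le_mul_of_nonneg_right (halow k) (sq_nonneg _)
      have h2 := norm_sub_le (t w) (e w)
      rw [htpe, add_sub_cancel_right, ← htpe, ht] at h2
      linarith [he w, norm_nonneg (WithLp.toLp 2 w)]
    intro v
    have h1 := norm_transpose_mulVec_le (M := Yᵀ) zero_le_two (fun w => ?_) v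
    · rwa [Matrix.transpose_transpose] at h1
    · have := hZl (Yᵀ *ᵥ w)
      rwa [hZYt] at this
  refine ⟨?_, hYu⟩
  -- Complementary slackness: the weights total `r`, which is also the weighted sum of squared
  -- norms, so positive weight forces contact with the sphere.
  have hslack : ∀ j, u j * (1 - ‖WithLp.toLp 2 (Y *ᵥ Xᵀ j)‖ ^ 2) = 0 := by
    have h1 : ∑ j, u j * (1 - ‖WithLp.toLp 2 (Y *ᵥ Xᵀ j)‖ ^ 2) = 0 := by
      have h2 := sum_weights_dotProduct hu 1
      simp_rw [Matrix.one_mulVec, mul_transpose_row, ← norm_toLp_sq] at h2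
      simp_rw [mul_sub, _root_.mul_one]
      rw [Finset.sum_sub_distrib, h2, hu1]
      simp
    have h3 := (Finset.sum_eq_zero_iff_of_nonneg fun j _ => mul_nonneg (hu0 j)
      (sub_nonneg.mpr ((sq_le_one_iff₀ (norm_nonneg _)).mpr (hcol j)))).mp h1
    exact fun j => h3 j (Finset.mem_univ j)
  -- Contact points of one cluster have inner product at least 3/5 with `Y x_i`, by the upper bound
  -- on `Y` just proved. Too much weight in the cluster would give `‖Y x_i‖ > 1`.
  have haup : ∀ k, a k ≤ (5 / 3) ^ 2 := fun k => by
    obtain ⟨i, rfl⟩ := hκ k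
    have h1 := sum_weights_dotProduct_sq hu (Y *ᵥ Xᵀ i)
    have h2 : a (κ i) * (3 / 5) ^ 2 ≤ ∑ j, u j * ((Y *ᵥ Xᵀ i) ⬝ᵥ (Y * X)ᵀ j) ^ 2 := by
      rw [ha, Finset.sum_mul]
      refine le_trans (Finset.sum_le_sum fun j hj => ?_)
        (Finset.sum_le_univ_sum_of_nonneg fun j => mul_nonneg (hu0 j) (sq_nonneg _))
      rcases (hu0 j).eq_or_lt with h0 | h0
      · simp [← h0]
      · refine mul_le_mul_of_nonneg_left (pow_le_pow_left₀ (by norm_num) ?_ 2) h0.le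
        have h3 : ‖WithLp.toLp 2 (Y *ᵥ Xᵀ j)‖ ^ 2 = 1 := by
          have := (mul_eq_zero.mp (hslack j)).resolve_left h0.ne'
          linarith
        have h4 : Xᵀ i = Xᵀ j + (m i - m j) := by
          have : κ j = κ i := (Finset.mem_filter.mp hj).2
          simp [hmdef, this]
        rw [mul_transpose_row, h4, Matrix.mulVec_add, add_dotProduct, ← norm_toLp_sq, h3]
        have h5 := (abs_le.mp (abs_dotProduct_le (Y *ᵥ (m i - m j)) (Y *ᵥ Xᵀ j))).1
        have h6 := hYu (m i - m j)
        have h7 : ‖WithLp.toLp 2 (m i - m j)‖ ≤ δ + δ := by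
          rw [WithLp.toLp_sub]
          exact (norm_sub_le _ _).trans (add_le_add (hm i) (hm j))
        have h8 : ‖WithLp.toLp 2 (Y *ᵥ (m i - m j))‖ * ‖WithLp.toLp 2 (Y *ᵥ Xᵀ j)‖ ≤ 2 / 5 :=
          (mul_le_of_le_one_right (norm_nonneg _) (hcol j)).trans (by linarith)
        linarith
    rw [h1] at h2
    have h3 : ‖WithLp.toLp 2 (Y *ᵥ Xᵀ i)‖ ^ 2 ≤ 1 := (sq_le_one_iff₀ (norm_nonneg _)).mpr (hcol i)
    nlinarith
  have hZu : ∀ w, ‖WithLp.toLp 2 (Z *ᵥ w)‖ ≤ 2 * ‖WithLp.toLp 2 w‖ := fun w => by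
    have h1 : ‖p w‖ ≤ 5 / 3 * ‖WithLp.toLp 2 w‖ := by
      refine abs_le_of_sq_le_sq' ?_ (by positivity) |>.2
      rw [mul_pow, hp, hwsq, Finset.mul_sum]
      exact Finset.sum_le_sum fun k _ => mul_le_mul_of_nonneg_right (haup k) (sq_nonneg _)
    have h2 := norm_add_le (p w) (e w)
    rw [← htpe, ht] at h2
    linarith [he w, norm_nonneg (WithLp.toLp 2 w)]
  intro v
  have h1 := norm_transpose_mulVec_le zero_le_two hZu (Y *ᵥ v)
  rw [hZ, Matrix.transpose_transpose, Matrix.mulVec_mulVec, Matrix.nonsing_inv_mul _ hY,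
    Matrix.one_mulVec] at h1
  linarith

lemma exists_right_inverse (X : Matrix (Fin r) (Fin n) ℝ)
    (hX : ∀ v : Fin r → ℝ, (∀ j, v ⬝ᵥ Xᵀ j = 0) → v = 0) :
    ∃ R : Matrix (Fin n) (Fin r) ℝ, X * R = 1 := by
  have hinj : Function.Injective (Matrix.vecMul · X) := by
    intro v w hvw
    refine sub_eq_zero.mp (hX _ fun j => ?_)
    have h1 := congrFun hvw j
    simp only [Matrix.vecMul] at h1
    rw [sub_dotProduct]
    exact sub_eq_zero.mpr h1
  have hpd := Matrix.PosDef.mul_conjTranspose_self X hinj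
  rw [Matrix.conjTranspose_eq_transpose_of_trivial] at hpd
  refine ⟨Xᵀ * (X * Xᵀ)⁻¹, ?_⟩
  rw [← Matrix.mul_assoc, Matrix.mul_nonsing_inv _ ((Matrix.isUnit_iff_isUnit_det _).mp hpd.isUnit)]

end Conditioning

/-! ### Conditioning of the ellipsoid in the presence of mixtures. -/

section NearSeparable

variable {r n : ℕ}

/-- A mixture which is far from all the vertices lies inside every well conditioned ellipsoid which
contains the vertices up to a small error. -/
lemma norm_mulVec_mixture_le {Y : Matrix (Fin r) (Fin r) ℝ}
    (hYl : ∀ v, ‖WithLp.toLp 2 v‖ / 2 ≤ ‖WithLp.toLp 2 (Y *ᵥ v)‖) {δ : ℝ} (hδ0 : 0 ≤ δ)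
    (hδ1 : δ ≤ 1 / 30000)
    (hvert : ∀ l, ‖WithLp.toLp 2 (Y *ᵥ Pi.single l 1)‖ ≤ 1 + 2 * δ) (h : Fin r → ℝ)
    (h0 : ∀ l, 0 ≤ h l) (h1 : ∑ l, h l = 1) (hmix : ∀ l, h l ≤ 1 - 48 * δ) :
    ‖WithLp.toLp 2 (Y *ᵥ h)‖ ≤ 1 - 2 * δ := by
  set q : Fin r → EuclideanSpace ℝ (Fin r) := fun l => WithLp.toLp 2 (Y *ᵥ Pi.single l 1) with hq
  have hsum : ∑ l, h l • q l = WithLp.toLp 2 (Y *ᵥ h) := by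
    conv_rhs => rw [pi_eq_sum_univ' h]
    rw [Matrix.mulVec_sum, WithLp.toLp_sum]
    refine Finset.sum_congr rfl fun l _ => ?_
    rw [Matrix.mulVec_smul, WithLp.toLp_smul]
  have hvar := sum_mul_norm_sub_sq h h1 q
  rw [hsum] at hvar
  have hup : ∑ l, h l * ‖q l‖ ^ 2 ≤ (1 + 2 * δ) ^ 2 := by
    calc ∑ l, h l * ‖q l‖ ^ 2 ≤ ∑ l, h l * (1 + 2 * δ) ^ 2 :=
          Finset.sum_le_sum fun l _ => mul_le_mul_of_nonneg_left
            (pow_le_pow_left₀ (norm_nonneg _) (hvert l) 2) (h0 l)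
      _ = (1 + 2 * δ) ^ 2 := by rw [← Finset.sum_mul, h1, one_mul]
  have hlow : 24 * δ ≤ ∑ i, ∑ j, h i * h j * ‖q i - q j‖ ^ 2 := by
    have hsep : ∀ i j, i ≠ j → 1 / 2 ≤ ‖q i - q j‖ ^ 2 := fun i j hij => by
      have h3 := hYl (Pi.single i 1 - Pi.single j 1)
      rw [Matrix.mulVec_sub, WithLp.toLp_sub _ (Y *ᵥ _)] at h3
      have h4 : ‖WithLp.toLp 2 (Pi.single i 1 - Pi.single j 1 : Fin r → ℝ)‖ ^ 2 = 2 := by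
        rw [norm_toLp_sq, dotProduct_sub, dotProduct_single_one, dotProduct_single_one]
        simp [hij, hij.symm]
        norm_num
      have h5 := pow_le_pow_left₀ (by positivity) h3 2
      rw [div_pow, h4] at h5
      simp only [hq]
      linarith
    have hrow : ∀ i, h i * (24 * δ) ≤ ∑ j, h i * h j * ‖q i - q j‖ ^ 2 := fun i => by
      have h3 : ∑ j ∈ Finset.univ.erase i, h j = 1 - h i := by
        rw [← h1, ← Finset.add_sum_erase _ _ (Finset.mem_univ i)]; ring
      calc h i * (24 * δ) ≤ h i * (∑ j ∈ Finset.univ.erase i, h j * (1 / 2)) := by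
            rw [← Finset.sum_mul, h3]
            exact mul_le_mul_of_nonneg_left (by linarith [hmix i]) (h0 i)
        _ = ∑ j ∈ Finset.univ.erase i, h i * h j * (1 / 2) := by
            rw [Finset.mul_sum]
            exact Finset.sum_congr rfl fun j _ => (mul_assoc _ _ _).symm
        _ ≤ ∑ j ∈ Finset.univ.erase i, h i * h j * ‖q i - q j‖ ^ 2 :=
            Finset.sum_le_sum fun j hj => mul_le_mul_of_nonneg_left
              (hsep i j (Finset.ne_of_mem_erase hj).symm) (mul_nonneg (h0 i) (h0 j))
        _ ≤ _ := Finset.sum_le_univ_sum_of_nonneg fun j =>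
            mul_nonneg (mul_nonneg (h0 i) (h0 j)) (sq_nonneg _)
    calc 24 * δ = ∑ i, h i * (24 * δ) := by rw [← Finset.sum_mul, h1, one_mul]
      _ ≤ _ := Finset.sum_le_sum fun i _ => hrow i
  refine abs_le_of_sq_le_sq' ?_ (by linarith) |>.2
  -- Half the pair sum removes `12 * δ` from `(1 + 2 * δ) ^ 2`, which leaves at most `(1 - 2 * δ) ^
  -- 2`.
  nlinarith

/-- The minimum volume ellipsoid of a near-separable matrix whose vertices are the basis vectors is
well conditioned. -/
theorem IsMinVolEllipsoid.conditioning_of_near_separable (hr : 0 < r)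
    {X : Matrix (Fin r) (Fin n) ℝ} {Y : Matrix (Fin r) (Fin r) ℝ}
    (hmin : IsMinVolEllipsoid X (Yᵀ * Y)) (h : Fin n → Fin r → ℝ) (h0 : ∀ j l, 0 ≤ h j l)
    (h1 : ∀ j, ∑ l, h j l = 1) (hpure : ∀ l, ∃ j, h j = Pi.single l 1) {δ : ℝ} (hδ0 : 0 ≤ δ)
    (hm : ∀ j, ‖WithLp.toLp 2 (Xᵀ j - h j)‖ ≤ δ) (hδ : √r * δ ≤ 1 / 30000) :
    (∀ v, ‖WithLp.toLp 2 v‖ / 2 ≤ ‖WithLp.toLp 2 (Y *ᵥ v)‖) ∧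
      ∀ v, ‖WithLp.toLp 2 (Y *ᵥ v)‖ ≤ 2 * ‖WithLp.toLp 2 v‖ := by
  have hr1 : 1 ≤ √(r : ℝ) := by
    rw [Real.one_le_sqrt]; exact_mod_cast (by omega : 1 ≤ r)
  have hδ1 : δ ≤ 1 / 30000 := by nlinarith
  have : Nonempty (Fin r) := ⟨⟨0, hr⟩⟩
  choose ι hι using hpure
  have hmaxi : ∀ j, ∃ k, ∀ l, h j l ≤ h j k := fun j => Finite.exists_max _
  choose κ hκ using hmaxi
  have hκι : ∀ k, κ (ι k) = k := fun k => by
    have h2 := hκ (ι k) k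
    by_contra hne
    rw [hι] at h2
    simp [hne] at h2
    linarith
  -- Columns far from every vertex are replaced by copies of a pure column, so that all columns of
  -- `X'` are near basis vectors. Pure columns are kept by `hφι`.
  set φ : Fin n → Fin n := fun j => if 1 - 48 * δ ≤ h j (κ j) then j else ι (κ j) with hφ
  have hφι : ∀ k, φ (ι k) = ι k := fun k => by
    simp only [hφ, hκι]
    rw [ite_id]
  set X' := X.submatrix id φ with hX'
  have hX'col : ∀ j, X'ᵀ j = Xᵀ (φ j) := fun j => rfl
  have hvert : ∀ l, ‖WithLp.toLp 2 (Xᵀ (ι l) - Pi.single l 1)‖ ≤ δ := fun l => by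
    rw [← hι l]; exact hm _
  have hm' : ∀ j, ‖WithLp.toLp 2 (X'ᵀ j - Pi.single (κ j) 1)‖ ≤ 97 * δ := fun j => by
    rw [hX'col]
    simp only [hφ]
    split_ifs with hj
    · have h2 : ‖WithLp.toLp 2 (h j - Pi.single (κ j) 1)‖ ≤ 2 * (1 - h j (κ j)) :=
        norm_sub_single_le (WithLp.toLp 2 (h j)) (h0 j) (h1 j) (κ j)
      have h3 : WithLp.toLp 2 (Xᵀ j - Pi.single (κ j) 1) =
          WithLp.toLp 2 (Xᵀ j - h j) + WithLp.toLp 2 (h j - Pi.single (κ j) 1) := by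
        rw [← WithLp.toLp_add, sub_add_sub_cancel]
      rw [h3]
      refine (norm_add_le _ _).trans ?_
      linarith [hm j]
    · linarith [hvert (κ j)]
  have hspan : ∀ v : Fin r → ℝ, (∀ j, v ⬝ᵥ X'ᵀ j = 0) → v = 0 := by
    intro v hv
    have h2 : ∀ k, v k ^ 2 ≤ (‖WithLp.toLp 2 v‖ * δ) ^ 2 := fun k => by
      have h3 := hv (ι k)
      rw [hX'col, hφι] at h3
      have h4 : v ⬝ᵥ (Xᵀ (ι k) - Pi.single k 1) = -v k := by
        rw [dotProduct_sub, h3, dotProduct_single_one]; ring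
      have h5 := abs_dotProduct_le v (Xᵀ (ι k) - Pi.single k 1)
      rw [h4, abs_neg] at h5
      rw [← sq_abs]
      exact pow_le_pow_left₀ (abs_nonneg _)
        (h5.trans (mul_le_mul_of_nonneg_left (hvert k) (norm_nonneg _))) 2
    have h3 : ‖WithLp.toLp 2 v‖ ^ 2 ≤ ‖WithLp.toLp 2 v‖ ^ 2 * (√r * δ) ^ 2 := by
      rw [mul_pow, Real.sq_sqrt (Nat.cast_nonneg _)]
      calc ‖WithLp.toLp 2 v‖ ^ 2 = ∑ k, v k ^ 2 := by
            rw [norm_toLp_sq, dotProduct]; simp_rw [pow_two]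
        _ ≤ ∑ _k : Fin r, (‖WithLp.toLp 2 v‖ * δ) ^ 2 := Finset.sum_le_sum fun k _ => h2 k
        _ = _ := by
            rw [Finset.sum_const, Finset.card_univ, Fintype.card_fin, nsmul_eq_mul]; ring
    have h4 : (√r * δ) ^ 2 ≤ 1 / 2 := by
      have : 0 ≤ √r * δ := by positivity
      nlinarith
    have h5 : ‖WithLp.toLp 2 v‖ ^ 2 = 0 := by nlinarith [sq_nonneg ‖WithLp.toLp 2 v‖]
    simpa using h5
  obtain ⟨R, hR⟩ := exists_right_inverse X' hspan
  obtain ⟨Y', hY'⟩ := exists_isMinVolEllipsoid X' R hR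
  obtain ⟨hl', hu'⟩ := hY'.conditioning_of_near_basis hr κ (fun k => ⟨ι k, hκι k⟩)
    (by positivity : 0 ≤ 97 * δ) hm' (by linarith)
  have hquad : ∀ (T : Matrix (Fin r) (Fin r) ℝ) (v : Fin r → ℝ),
      v ⬝ᵥ (Tᵀ * T) *ᵥ v = ‖WithLp.toLp 2 (T *ᵥ v)‖ ^ 2 := fun T v => by
    rw [norm_toLp_sq, ← Matrix.mulVec_mulVec, Matrix.dotProduct_mulVec, Matrix.vecMul_transpose]
  have hle' : ∀ j, ‖WithLp.toLp 2 (Y' *ᵥ X'ᵀ j)‖ ≤ 1 := fun j => by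
    have h2 := hY'.1.2 j
    rw [hquad] at h2
    exact (sq_le_one_iff₀ (norm_nonneg _)).mp h2
  have hvert' : ∀ l, ‖WithLp.toLp 2 (Y' *ᵥ Pi.single l 1)‖ ≤ 1 + 2 * δ := fun l => by
    have h2 := hle' (ι l)
    rw [hX'col, hφι] at h2
    have h3 : WithLp.toLp 2 (Y' *ᵥ Pi.single l 1) =
        WithLp.toLp 2 (Y' *ᵥ Xᵀ (ι l)) - WithLp.toLp 2 (Y' *ᵥ (Xᵀ (ι l) - Pi.single l 1)) := by
      rw [Matrix.mulVec_sub, ← WithLp.toLp_sub, sub_sub_cancel]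
    rw [h3]
    refine (norm_sub_le _ _).trans ?_
    linarith [hu' (Xᵀ (ι l) - Pi.single l 1), hvert l]
  -- The ellipsoid of the reduced points also contains the discarded mixtures: these lie at depth `2
  -- * δ`, which absorbs the noise magnified by at most 2.
  have hencl : IsEnclosingEllipsoid X (Y'ᵀ * Y') := by
    refine ⟨hY'.1.1, fun j => ?_⟩
    by_cases hj : 1 - 48 * δ ≤ h j (κ j)
    · have h2 := hY'.1.2 j
      have h3 : φ j = j := if_pos hj
      rwa [hX'col, h3] at h2
    · rw [hquad, sq_le_one_iff₀ (norm_nonneg _)]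
      have h2 := norm_mulVec_mixture_le hl' hδ0 hδ1 hvert' (h j) (h0 j) (h1 j)
        fun l => (hκ j l).trans (by linarith)
      have h3 : WithLp.toLp 2 (Y' *ᵥ Xᵀ j) =
          WithLp.toLp 2 (Y' *ᵥ h j) + WithLp.toLp 2 (Y' *ᵥ (Xᵀ j - h j)) := by
        rw [← WithLp.toLp_add, ← Matrix.mulVec_add, add_sub_cancel]
      rw [h3]
      refine (norm_add_le _ _).trans ?_
      linarith [hu' (Xᵀ j - h j), hm j]
  -- The ellipsoid of `X` encloses `X'` and has no larger volume than that of `X'`, so uniqueness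
  -- identifies the two.
  have heq := hY'.eq_of_det_le hr (L := Yᵀ * Y)
    ⟨hmin.1.1, fun j => hmin.1.2 (φ j)⟩ (hmin.2 _ hencl)
  have hnorm : ∀ v, ‖WithLp.toLp 2 (Y *ᵥ v)‖ = ‖WithLp.toLp 2 (Y' *ᵥ v)‖ := fun v => by
    rw [← sq_eq_sq₀ (norm_nonneg _) (norm_nonneg _), ← hquad, ← hquad, heq]
  simp_rw [hnorm]
  exact ⟨hl', hu'⟩

end NearSeparable

/-! ### Variational bounds for singular values, indexed from 0. -/

section SingularValues

open Module

variable {E F : Type*} [NormedAddCommGroup E] [InnerProductSpace ℝ E] [FiniteDimensional ℝ E]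
  [NormedAddCommGroup F] [InnerProductSpace ℝ F] [FiniteDimensional ℝ F]

lemma norm_sq_eq_sum_singularValues (T : E →ₗ[ℝ] F) {N : ℕ} (hN : finrank ℝ E = N) (v : E) :
    ‖T v‖ ^ 2 = ∑ i : Fin N, T.singularValues i ^ 2 *
      inner ℝ (T.isSymmetric_adjoint_comp_self.eigenvectorBasis hN i) v ^ 2 := by
  set b := T.isSymmetric_adjoint_comp_self.eigenvectorBasis hN with hb
  have h1 : ‖T v‖ ^ 2 = inner ℝ v ((LinearMap.adjoint T ∘ₗ T) v) := by
    rw [← real_inner_self_eq_norm_sq, LinearMap.comp_apply, LinearMap.adjoint_inner_right]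
  rw [h1, ← b.sum_inner_mul_inner]
  refine Finset.sum_congr rfl fun i _ => ?_
  rw [← T.isSymmetric_adjoint_comp_self, hb, LinearMap.IsSymmetric.apply_eigenvectorBasis,
    inner_smul_left, T.sq_singularValues_fin hN, real_inner_comm]
  simp
  ring

lemma norm_le_singularValues_zero_mul (T : E →ₗ[ℝ] F) (v : E) :
    ‖T v‖ ≤ T.singularValues 0 * ‖v‖ := by
  have h0 := T.singularValues_nonneg 0
  refine abs_le_of_sq_le_sq' ?_ (by positivity) |>.2
  rw [norm_sq_eq_sum_singularValues T rfl, mul_pow,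
    ← OrthonormalBasis.sum_sq_inner_right
      (T.isSymmetric_adjoint_comp_self.eigenvectorBasis rfl) v, Finset.mul_sum]
  refine Finset.sum_le_sum fun i _ => mul_le_mul_of_nonneg_right ?_ (sq_nonneg _)
  exact pow_le_pow_left₀ (T.singularValues_nonneg _) (T.singularValues_antitone (Nat.zero_le _)) 2

lemma singularValues_mul_norm_le (T : E →ₗ[ℝ] F) {k : ℕ} (hk : finrank ℝ E ≤ k + 1) (v : E) :
    T.singularValues k * ‖v‖ ≤ ‖T v‖ := by
  refine abs_le_of_sq_le_sq' ?_ (norm_nonneg _) |>.2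
  rw [norm_sq_eq_sum_singularValues T rfl, mul_pow,
    ← OrthonormalBasis.sum_sq_inner_right
      (T.isSymmetric_adjoint_comp_self.eigenvectorBasis rfl) v, Finset.mul_sum]
  refine Finset.sum_le_sum fun i _ => mul_le_mul_of_nonneg_right ?_ (sq_nonneg _)
  exact pow_le_pow_left₀ (T.singularValues_nonneg _)
    (T.singularValues_antitone (by have := i.2; omega)) 2

/-- The min-max bound on a singular value, from a subspace of codimension at most `k` on which the
map is small. -/
lemma singularValues_le_of_forall {ι : Type*} [Fintype ι] (T : E →ₗ[ℝ] F) (φ : ι → E →ₗ[ℝ] ℝ)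
    {k : ℕ} (hk : Fintype.card ι ≤ k) {c : ℝ} (hc : 0 ≤ c)
    (h : ∀ v, (∀ i, φ i v = 0) → ‖T v‖ ≤ c * ‖v‖) : T.singularValues k ≤ c := by
  rcases le_or_gt (finrank ℝ E) k with hkN | hkN
  · rwa [T.singularValues_of_finrank_le hkN]
  set b := T.isSymmetric_adjoint_comp_self.eigenvectorBasis rfl with hb
  let f : E →ₗ[ℝ] ({i : Fin (finrank ℝ E) // k < i} ⊕ ι → ℝ) :=
    LinearMap.pi (Sum.elim (fun i => (innerSL ℝ (b i)).toLinearMap) φ)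
  have hcard : Fintype.card {i : Fin (finrank ℝ E) // k < i} = finrank ℝ E - 1 - k := by
    rw [Fintype.card_subtype]
    have : (Finset.univ.filter fun i : Fin (finrank ℝ E) => k < i) = Finset.Ioi ⟨k, hkN⟩ := by
      ext i; simp [Fin.lt_def]
    rw [this, Fin.card_Ioi]
  -- Dimension count: at most `k` constraints from `φ` and `finrank - 1 - k` from the lower singular
  -- vectors leave a nonzero vector in the span of the top `k + 1`.
  have hker : LinearMap.ker f ≠ ⊥ := by
    refine f.ker_ne_bot_of_finrank_lt ?_
    rw [finrank_pi, Fintype.card_sum, hcard]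
    omega
  obtain ⟨v, hv, hv0⟩ := (Submodule.ne_bot_iff _).mp hker
  rw [LinearMap.mem_ker] at hv
  have hv1 : ∀ i : Fin (finrank ℝ E), k < i → inner ℝ (b i) v = 0 := fun i hi =>
    congrFun hv (Sum.inl ⟨i, hi⟩)
  have hv2 : ∀ i, φ i v = 0 := fun i => congrFun hv (Sum.inr i)
  have hlow : T.singularValues k * ‖v‖ ≤ ‖T v‖ := by
    refine abs_le_of_sq_le_sq' ?_ (norm_nonneg _) |>.2
    rw [norm_sq_eq_sum_singularValues T rfl, mul_pow, ← OrthonormalBasis.sum_sq_inner_right b v,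
      Finset.mul_sum]
    refine Finset.sum_le_sum fun i _ => ?_
    rcases le_or_gt (i : ℕ) k with hi | hi
    · exact mul_le_mul_of_nonneg_right (pow_le_pow_left₀ (T.singularValues_nonneg _)
        (T.singularValues_antitone hi) 2) (sq_nonneg _)
    · rw [← hb, hv1 i hi]; simp
  exact le_of_mul_le_mul_right (hlow.trans (h v hv2)) (norm_pos_iff.mpr hv0)

/-- A symmetric map whose eigenvalues are bounded by `c` is bounded by `c`. -/
lemma norm_le_of_hasEigenvalue_le {T : E →ₗ[ℝ] E} (hT : T.IsSymmetric) {c : ℝ} (hc : 0 ≤ c)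
    (h : ∀ (μ : ℝ) (v : E), v ≠ 0 → T v = μ • v → |μ| ≤ c) (v : E) : ‖T v‖ ≤ c * ‖v‖ := by
  refine abs_le_of_sq_le_sq' ?_ (by positivity) |>.2
  set b := hT.eigenvectorBasis rfl with hb
  rw [mul_pow, ← OrthonormalBasis.sum_sq_inner_right b, ← OrthonormalBasis.sum_sq_inner_right b v,
    Finset.mul_sum]
  refine Finset.sum_le_sum fun i _ => ?_
  have h1 := hT.apply_eigenvectorBasis rfl i
  rw [← hT, hb, h1, inner_smul_left, mul_pow]
  refine mul_le_mul_of_nonneg_right ?_ (sq_nonneg _)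
  have h2 := h _ _ (b.orthonormal.ne_zero i) (by rw [hb]; exact h1)
  rw [← sq_abs]
  exact pow_le_pow_left₀ (abs_nonneg _) h2 2

end SingularValues

/-! ### Lower bounds for the leading eigenvalues. -/

section Leading

variable {n K : ℕ}

lemma toEuclideanLin_isSymmetric {M : Matrix (Fin n) (Fin n) ℝ} (hM : M.IsSymm) :
    (Matrix.toEuclideanLin M).IsSymmetric := by
  rw [Matrix.isSymmetric_toEuclideanLin_iff, Matrix.IsHermitian,
    Matrix.conjTranspose_eq_transpose_of_trivial]
  exact hM

/-- A leading eigenvalue of a perturbation of `P` is bounded below by a singular value of `P`. -/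
lemma singVal_le_abs_eigenvalue_add {A P : Matrix (Fin n) (Fin n) ℝ} (hA : A.IsSymm)
    {U : Matrix (Fin n) (Fin K) ℝ} {l : Fin K → ℝ} (hAU : A * U = U * Matrix.diagonal l)
    (hl : ∀ (μ : ℝ) (v : Fin n → ℝ), v ≠ 0 → A *ᵥ v = μ • v → Uᵀ *ᵥ v = 0 → ∀ k, |μ| ≤ |l k|)
    (k : Fin K) : singVal P K ≤ |l k| + specNorm (A - P) := by
  have hUA : ∀ v, Uᵀ *ᵥ (A *ᵥ v) = fun j => l j * (Uᵀ *ᵥ v) j := fun v => by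
    have h1 : Uᵀ * A = Matrix.diagonal l * Uᵀ := by
      have := congrArg Matrix.transpose hAU
      rwa [Matrix.transpose_mul, Matrix.transpose_mul, hA, Matrix.diagonal_transpose] at this
    rw [Matrix.mulVec_mulVec, h1, ← Matrix.mulVec_mulVec]
    funext j
    rw [Matrix.mulVec_diagonal]
  let φ : {j : Fin K // j ≠ k} → EuclideanSpace ℝ (Fin n) →ₗ[ℝ] ℝ := fun j =>
    LinearMap.proj j.1 ∘ₗ Uᵀ.mulVecLin ∘ₗ (WithLp.linearEquiv 2 ℝ (Fin n → ℝ)).toLinearMap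
  have hφ : ∀ j v, φ j v = (Uᵀ *ᵥ v.ofLp) j := fun j v => rfl
  -- `V` is orthogonal to all columns of `U` except the `k`-th. It is `A`-invariant, and eigenvalues
  -- of `A` on it are either `l k` or non-leading, hence at most `|l k|` in modulus. Only `K - 1`
  -- constraints define it, so min-max applies to the `K`-th singular value of `P`.
  let V : Submodule ℝ (EuclideanSpace ℝ (Fin n)) := ⨅ j, LinearMap.ker (φ j)
  have hV : ∀ v, v ∈ V ↔ ∀ j ≠ k, (Uᵀ *ᵥ v.ofLp) j = 0 := fun v => by
    simp [V, Submodule.mem_iInf, hφ]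
  have hinv : ∀ v ∈ V, Matrix.toEuclideanLin A v ∈ V := fun v hv => by
    rw [hV] at hv ⊢
    intro j hj
    change (Uᵀ *ᵥ (A *ᵥ v.ofLp)) j = 0
    rw [hUA]
    simp only [hv j hj, mul_zero]
  have hres : ∀ v ∈ V, ‖Matrix.toEuclideanLin A v‖ ≤ |l k| * ‖v‖ := fun v hv => by
    refine norm_le_of_hasEigenvalue_le
      ((toEuclideanLin_isSymmetric hA).restrict_invariant hinv) (abs_nonneg (l k)) ?_ ⟨v, hv⟩
    rintro μ ⟨w, hw⟩ hw0 hμ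
    have hμ' : A *ᵥ w.ofLp = μ • w.ofLp := by
      have := congrArg (fun x : V => (x : EuclideanSpace ℝ (Fin n)).ofLp) hμ
      exact this
    have hw0' : w.ofLp ≠ 0 := by
      intro h0
      exact hw0 (Subtype.ext (by ext i; exact congrFun h0 i))
    rw [hV] at hw
    by_cases hk : (Uᵀ *ᵥ w.ofLp) k = 0
    · refine hl μ _ hw0' hμ' ?_ k
      funext j
      by_cases hj : j = k
      · rw [hj, hk]; rfl
      · exact hw j hj
    · have h1 := congrFun (hUA w.ofLp) k
      rw [hμ', Matrix.mulVec_smul, Pi.smul_apply, smul_eq_mul] at h1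
      rw [mul_right_cancel₀ hk h1]
  refine singularValues_le_of_forall _ φ ?_ (add_nonneg (abs_nonneg _) (norm_nonneg _)) ?_
  · rw [Fintype.card_subtype_compl]
    simp
  · intro v hv
    have h1 := hres v ((hV v).mpr fun j hj => hv ⟨j, hj⟩)
    have h2 : Matrix.toEuclideanLin P v =
        Matrix.toEuclideanLin A v - Matrix.toEuclideanCLM (n := Fin n) (𝕜 := ℝ) (A - P) v := by
      have h3 : Matrix.toEuclideanCLM (n := Fin n) (𝕜 := ℝ) (A - P) v =
          Matrix.toEuclideanLin (A - P) v := rfl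
      rw [h3, map_sub, LinearMap.sub_apply, sub_sub_cancel]
    rw [h2, add_mul]
    exact (norm_sub_le _ _).trans (add_le_add h1 (ContinuousLinearMap.le_opNorm _ _))

lemma singVal_antitone {m d : ℕ} (M : Matrix (Fin m) (Fin d) ℝ) : Antitone (singVal M) :=
  fun _ _ h => LinearMap.singularValues_antitone _ (Nat.sub_le_sub_right h 1)

lemma singVal_pos_of_le_rank {m d : ℕ} (M : Matrix (Fin m) (Fin d) ℝ) (hK : 0 < K)
    (h : K ≤ M.rank) : 0 < singVal M K := by
  rw [singVal, LinearMap.singularValues_pos_iff_lt_finrank_range, Matrix.toEuclideanLin,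
    Matrix.toLpLin_eq_toLin,
    ← Matrix.rank_eq_finrank_range_toLin]
  omega

lemma one_le_condNum {m d : ℕ} (M : Matrix (Fin m) (Fin d) ℝ) (hK : 0 < K)
    (h : 0 < singVal M K) : 1 ≤ condNum K M := by
  rw [condNum, one_le_div h]
  exact singVal_antitone M hK

end Leading

/-! ### Row-wise eigenvector perturbation. -/

section RowBound

open scoped Matrix.Norms.L2Operator

lemma norm_mulVec_le_opNorm {m d : ℕ} (M : Matrix (Fin m) (Fin d) ℝ) (v : Fin d → ℝ) :
    ‖WithLp.toLp 2 (M *ᵥ v)‖ ≤ ‖M‖ * ‖WithLp.toLp 2 v‖ :=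
  M.l2_opNorm_mulVec (WithLp.toLp 2 v)

lemma opNorm_le_of_forall {m d : ℕ} {M : Matrix (Fin m) (Fin d) ℝ} {c : ℝ} (hc : 0 ≤ c)
    (h : ∀ v, ‖WithLp.toLp 2 (M *ᵥ v)‖ ≤ c * ‖WithLp.toLp 2 v‖) : ‖M‖ ≤ c := by
  rw [Matrix.l2_opNorm_def]
  exact ContinuousLinearMap.opNorm_le_bound _ hc fun v => h v.ofLp

lemma opNorm_transpose {m d : ℕ} (M : Matrix (Fin m) (Fin d) ℝ) : ‖Mᵀ‖ = ‖M‖ := by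
  rw [← Matrix.conjTranspose_eq_transpose_of_trivial, Matrix.l2_opNorm_conjTranspose]

lemma opNorm_transpose_mul_self {m d : ℕ} (M : Matrix (Fin m) (Fin d) ℝ) :
    ‖Mᵀ * M‖ = ‖M‖ ^ 2 := by
  rw [← Matrix.conjTranspose_eq_transpose_of_trivial, Matrix.l2_opNorm_conjTranspose_mul_self,
    pow_two]

lemma opNorm_le_one_of_orthonormal {m d : ℕ} {M : Matrix (Fin m) (Fin d) ℝ} (h : Mᵀ * M = 1) :
    ‖M‖ ≤ 1 := by
  refine opNorm_le_of_forall zero_le_one fun v => ?_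
  rw [one_mul, ← sq_le_sq₀ (norm_nonneg _) (norm_nonneg _), norm_toLp_sq, norm_toLp_sq,
    Matrix.dotProduct_mulVec, ← Matrix.mulVec_transpose, Matrix.mulVec_mulVec, h, Matrix.one_mulVec]

lemma opNorm_le_one_of_isIdempotent {m : ℕ} {M : Matrix (Fin m) (Fin m) ℝ} (h : Mᵀ * M = M) :
    ‖M‖ ≤ 1 := by
  have h1 := opNorm_transpose_mul_self M
  rw [h] at h1
  by_contra! hcon
  nlinarith

lemma rowNorm_nonneg {m d : ℕ} (M : Matrix (Fin m) (Fin d) ℝ) (i : Fin m) : 0 ≤ rowNorm M i :=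
  norm_nonneg _

lemma rowNorm_add_le {m d : ℕ} (M N : Matrix (Fin m) (Fin d) ℝ) (i : Fin m) :
    rowNorm (M + N) i ≤ rowNorm M i + rowNorm N i :=
  norm_add_le (WithLp.toLp 2 (M i)) (WithLp.toLp 2 (N i))

lemma rowNorm_mul_le {m d k : ℕ} (M : Matrix (Fin m) (Fin d) ℝ) (N : Matrix (Fin d) (Fin k) ℝ)
    (i : Fin m) : rowNorm (M * N) i ≤ rowNorm M i * ‖N‖ := by
  have h : (M * N) i = Nᵀ *ᵥ M i := by
    rw [Matrix.mulVec_transpose, Matrix.mul_apply_eq_vecMul]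
  rw [rowNorm, h, mul_comm, ← opNorm_transpose]
  exact norm_mulVec_le_opNorm _ _

lemma opNorm_diagonal_le {K : ℕ} {l : Fin K → ℝ} {c : ℝ} (hc : 0 < c) (h : ∀ k, c ≤ |l k|) :
    ‖Matrix.diagonal fun k => (l k)⁻¹‖ ≤ c⁻¹ := by
  rw [Matrix.l2_opNorm_diagonal, pi_norm_le_iff_of_nonneg (by positivity)]
  intro k
  rw [norm_inv, Real.norm_eq_abs]
  exact inv_anti₀ hc (h k)

/-- A near-isometry is close to an orthogonal matrix. -/
lemma exists_orthogonal_near {K : ℕ} (H : Matrix (Fin K) (Fin K) ℝ) {ε : ℝ}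
    (h : ‖1 - Hᵀ * H‖ ≤ ε) (hε : ε < 1) :
    ∃ O ∈ Matrix.orthogonalGroup (Fin K) ℝ, ‖O - H‖ ≤ ε := by
  have hpsd : (Hᵀ * H).PosSemidef := by
    rw [← Matrix.conjTranspose_eq_transpose_of_trivial]
    exact Matrix.posSemidef_conjTranspose_mul_self H
  obtain ⟨S, hS, hSS⟩ := exists_posSemidef_sqrt hpsd
  have hSt : Sᵀ = S := by
    rw [← Matrix.conjTranspose_eq_transpose_of_trivial]
    exact hS.1
  have hunit : IsUnit S.det := by
    rw [isUnit_iff_ne_zero]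
    intro h0
    obtain ⟨v, hv0, hv⟩ := Matrix.exists_mulVec_eq_zero_iff.mpr h0
    have h1 : (1 - Hᵀ * H) *ᵥ v = v := by
      rw [Matrix.sub_mulVec, Matrix.one_mulVec, ← hSS, ← Matrix.mulVec_mulVec, hv,
        Matrix.mulVec_zero, sub_zero]
    have h2 := norm_mulVec_le_opNorm (1 - Hᵀ * H) v
    rw [h1] at h2
    have h3 : 0 < ‖WithLp.toLp 2 v‖ := norm_pos_iff.mpr (by simpa using hv0)
    nlinarith
  have hOO : (H * S⁻¹)ᵀ * (H * S⁻¹) = 1 := by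
    rw [Matrix.transpose_mul, Matrix.transpose_nonsing_inv, hSt, Matrix.mul_assoc,
      ← Matrix.mul_assoc Hᵀ, ← hSS, Matrix.mul_assoc S, Matrix.mul_nonsing_inv _ hunit,
      Matrix.mul_one, Matrix.nonsing_inv_mul _ hunit]
  refine ⟨H * S⁻¹, (Matrix.mem_orthogonalGroup_iff' _ _).mpr hOO, ?_⟩
  have hfac : H * S⁻¹ - H = H * S⁻¹ * (1 - S) := by
    rw [Matrix.mul_sub, Matrix.mul_one, Matrix.mul_assoc, Matrix.nonsing_inv_mul _ hunit,
      Matrix.mul_one]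
  -- `1 - S ^ 2 = (1 + S) * (1 - S)`, and `1 + S` does not shrink vectors because `S` is positive
  -- semidefinite.
  have hS1 : ‖1 - S‖ ≤ ‖1 - Hᵀ * H‖ := by
    refine opNorm_le_of_forall (norm_nonneg _) fun v => ?_
    refine le_trans ?_ (norm_mulVec_le_opNorm (1 - Hᵀ * H) v)
    set w := (1 - S) *ᵥ v with hw
    have h1 : (1 - Hᵀ * H) *ᵥ v = w + S *ᵥ w := by
      rw [hw, ← hSS, Matrix.mulVec_mulVec, ← Matrix.add_mulVec]
      congr 1
      noncomm_ring
    have h2 : 0 ≤ w ⬝ᵥ S *ᵥ w := by simpa using hS.dotProduct_mulVec_nonneg w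
    rw [h1, ← sq_le_sq₀ (norm_nonneg _) (norm_nonneg _), norm_toLp_sq, norm_toLp_sq,
      add_dotProduct, dotProduct_add, dotProduct_add, dotProduct_comm (S *ᵥ w) w]
    have h3 : 0 ≤ (S *ᵥ w) ⬝ᵥ (S *ᵥ w) := by rw [← norm_toLp_sq]; positivity
    linarith
  rw [hfac]
  calc _ ≤ ‖H * S⁻¹‖ * ‖1 - S‖ := Matrix.l2_opNorm_mul _ _
    _ ≤ 1 * ‖1 - Hᵀ * H‖ := by
        gcongr
        exact opNorm_le_one_of_orthonormal hOO
    _ ≤ ε := by rwa [one_mul]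

variable {n K : ℕ}

/-- Two orthonormal families with small sines of the principal angles are aligned by an orthogonal
matrix. -/
lemma exists_orthogonal_align {U V : Matrix (Fin n) (Fin K) ℝ} (hU : Uᵀ * U = 1) (hV : Vᵀ * V = 1)
    {s : ℝ} (hs : ‖V - U * (Uᵀ * V)‖ ≤ s) (hs1 : s ≤ 1) :
    ∃ O ∈ Matrix.orthogonalGroup (Fin K) ℝ, ‖O - Uᵀ * V‖ ≤ 2 * s ∧ ‖V - U * O‖ ≤ 2 * s := by
  have hs0 : 0 ≤ s := (norm_nonneg _).trans hs
  have hUn := opNorm_le_one_of_orthonormal hU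
  have hVn := opNorm_le_one_of_orthonormal hV
  rcases hs1.lt_or_eq with hlt | rfl
  · have hid : 1 - (Uᵀ * V)ᵀ * (Uᵀ * V) = (V - U * (Uᵀ * V))ᵀ * (V - U * (Uᵀ * V)) := by
      have h1 : ∀ W : Matrix (Fin K) (Fin K) ℝ, Uᵀ * (U * W) = W := fun W => by
        rw [← Matrix.mul_assoc, hU, Matrix.one_mul]
      simp only [Matrix.transpose_sub, Matrix.transpose_mul, Matrix.transpose_transpose,
        Matrix.sub_mul, Matrix.mul_sub, Matrix.mul_assoc, hV, h1]
      abel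
    have hsq : ‖1 - (Uᵀ * V)ᵀ * (Uᵀ * V)‖ ≤ s ^ 2 := by
      rw [hid, opNorm_transpose_mul_self]
      exact pow_le_pow_left₀ (norm_nonneg _) hs 2
    obtain ⟨O, hO, hOH⟩ := exists_orthogonal_near _ hsq (by nlinarith)
    refine ⟨O, hO, hOH.trans (by nlinarith), ?_⟩
    have h1 : V - U * O = (V - U * (Uᵀ * V)) - U * (O - Uᵀ * V) := by
      rw [Matrix.mul_sub]; abel
    rw [h1]
    refine (norm_sub_le _ _).trans ?_
    have h2 : ‖U * (O - Uᵀ * V)‖ ≤ 1 * s ^ 2 := (Matrix.l2_opNorm_mul _ _).trans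
      (mul_le_mul hUn hOH (norm_nonneg _) zero_le_one)
    nlinarith
  · refine ⟨1, one_mem _, ?_, ?_⟩
    · have h1 : ‖(1 : Matrix (Fin K) (Fin K) ℝ)‖ ≤ 1 :=
        opNorm_le_one_of_orthonormal (by rw [Matrix.transpose_one, Matrix.mul_one])
      have h2 : ‖Uᵀ * V‖ ≤ 1 * 1 := (Matrix.l2_opNorm_mul _ _).trans
        (mul_le_mul (by rwa [opNorm_transpose]) hVn (norm_nonneg _) zero_le_one)
      exact (norm_sub_le _ _).trans (by linarith)
    · rw [Matrix.mul_one]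
      exact (norm_sub_le _ _).trans (by linarith)

lemma mul_diagonal_inv {m : ℕ} {M : Matrix (Fin m) (Fin n) ℝ} {U : Matrix (Fin n) (Fin K) ℝ}
    {V : Matrix (Fin m) (Fin K) ℝ} {l : Fin K → ℝ} (h : M * U = V * Matrix.diagonal l)
    (hl : ∀ k, l k ≠ 0) : M * U * (Matrix.diagonal fun k => (l k)⁻¹) = V := by
  rw [h, Matrix.mul_assoc, Matrix.diagonal_mul_diagonal]
  simp [hl]

/-- The row-wise perturbation bound for leading eigenvectors. -/
theorem exists_orthogonal_rowNorm_le {A P : Matrix (Fin n) (Fin n) ℝ} (hA : A.IsSymm)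
    (hP : P.IsSymm) {U V : Matrix (Fin n) (Fin K) ℝ} (hU : IsLeadingEigenvectors P U)
    (hV : IsLeadingEigenvectors A V) (hK : 0 < K) (hPU : U * (Uᵀ * P) = P)
    (hpos : 0 < singVal P K) (hAP : specNorm (A - P) ≤ singVal P K / 2) :
    ∃ O ∈ Matrix.orthogonalGroup (Fin K) ℝ, ∀ i, rowNorm (V - U * O) i ≤ betaRow A P U i := by
  obtain ⟨hUU, l, hl, hlmax⟩ := hU
  obtain ⟨hVV, m, hm, hmmax⟩ := hV
  set lam := singVal P K with hlam
  set e := specNorm (A - P) with he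
  have hee : ‖A - P‖ = e := rfl
  have he0 : 0 ≤ e := norm_nonneg _
  have hll : ∀ k, lam ≤ |l k| := fun k => by
    have h1 := singVal_le_abs_eigenvalue_add (P := P) hP hl hlmax k
    have h2 : specNorm (P - P) = 0 := by rw [sub_self, specNorm, map_zero, norm_zero]
    rwa [h2, add_zero] at h1
  have hml : ∀ k, lam / 2 ≤ |m k| := fun k => by
    have h1 := singVal_le_abs_eigenvalue_add (P := P) hA hm hmmax k
    linarith
  have hl0 : ∀ k, l k ≠ 0 := fun k => abs_pos.mp (hpos.trans_le (hll k))
  have hm0 : ∀ k, m k ≠ 0 := fun k => abs_pos.mp ((half_pos hpos).trans_le (hml k))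
  set Li := Matrix.diagonal fun k => (l k)⁻¹ with hLi
  set Mi := Matrix.diagonal fun k => (m k)⁻¹ with hMi
  have hLn : ‖Li‖ ≤ lam⁻¹ := opNorm_diagonal_le hpos hll
  have hMn : ‖Mi‖ ≤ 2 * lam⁻¹ := by
    have h1 := opNorm_diagonal_le (half_pos hpos) hml
    rwa [inv_div, div_eq_mul_inv] at h1
  have hPLi : P * U * Li = U := mul_diagonal_inv hl hl0
  have hAMi : A * V * Mi = V := mul_diagonal_inv hm hm0
  have hUn := opNorm_le_one_of_orthonormal hUU
  have hVn := opNorm_le_one_of_orthonormal hVV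
  set H := Uᵀ * V with hH
  set s := 2 * lam⁻¹ * e with hs
  have hs1 : s ≤ 1 := by
    rw [hs, mul_assoc, inv_mul_eq_div]
    have : e / lam ≤ 1 / 2 := by rw [div_le_iff₀ hpos]; linarith
    linarith
  set Q := 1 - U * Uᵀ with hQ
  have hQn : ‖Q‖ ≤ 1 := by
    refine opNorm_le_one_of_isIdempotent ?_
    have h1 : Uᵀ * (U * Uᵀ) = Uᵀ := by rw [← Matrix.mul_assoc, hUU, Matrix.one_mul]
    rw [hQ, Matrix.transpose_sub, Matrix.transpose_one, Matrix.transpose_mul,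
      Matrix.transpose_transpose, Matrix.sub_mul, Matrix.one_mul, Matrix.mul_sub, Matrix.mul_one,
      Matrix.mul_assoc, h1, sub_self, sub_zero]
  have hSid : V - U * H = Q * (A - P) * V * Mi := by
    -- `Q` projects off the column space of `U`, which contains the range of `P`. Hence `Q * A = Q *
    -- (A - P)`, the Davis–Kahan step.
    have h1 : Q * P = 0 := by
      rw [hQ, Matrix.sub_mul, Matrix.one_mul, Matrix.mul_assoc, hPU, sub_self]
    calc V - U * H = Q * V := by
          rw [hQ, Matrix.sub_mul, Matrix.one_mul, Matrix.mul_assoc]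
      _ = Q * (A * V * Mi) := by rw [hAMi]
      _ = _ := by
          rw [Matrix.mul_sub Q, h1, sub_zero]
          simp only [Matrix.mul_assoc]
  have hEV : ‖Q * (A - P) * V * Mi‖ ≤ s := by
    calc _ ≤ ‖Q * (A - P) * V‖ * ‖Mi‖ := Matrix.l2_opNorm_mul _ _
      _ ≤ (‖Q * (A - P)‖ * ‖V‖) * ‖Mi‖ := by gcongr; exact Matrix.l2_opNorm_mul _ _
      _ ≤ ((‖Q‖ * ‖A - P‖) * ‖V‖) * ‖Mi‖ := by gcongr; exact Matrix.l2_opNorm_mul _ _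
      _ ≤ ((1 * e) * 1) * (2 * lam⁻¹) := by rw [hee]; gcongr
      _ = s := by rw [hs]; ring
  obtain ⟨O, hO, hOH, hVO⟩ := exists_orthogonal_align hUU hVV (by rw [← hH, hSid]; exact hEV) hs1
  rw [← hH] at hOH
  refine ⟨O, hO, fun i => ?_⟩
  have hOn : ‖O‖ ≤ 1 :=
    opNorm_le_one_of_orthonormal ((Matrix.mem_orthogonalGroup_iff' _ _).mp hO)
  -- `O` nearly intertwines the inverse eigenvalue matrices: `H = Uᵀ * V` does so up to a term in `A
  -- - P`, and `O` is close to `H`. No gap among the leading eigenvalues is needed.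
  have hcomm : O * Mi - Li * O =
      (O - H) * Mi - Li * (O - H) - Li * (Uᵀ * ((A - P) * V)) * Mi := by
    have h1 : Li * (Uᵀ * P) = Uᵀ := by
      have := congrArg Matrix.transpose hPLi
      rwa [Matrix.transpose_mul, Matrix.transpose_mul, hP, hLi, Matrix.diagonal_transpose] at this
    have h2 : Li * (Uᵀ * ((A - P) * V)) * Mi = Li * H - H * Mi := by
      calc _ = Li * (Uᵀ * (A * V * Mi)) - Li * (Uᵀ * P) * V * Mi := by
            simp only [Matrix.sub_mul, Matrix.mul_sub, Matrix.mul_assoc]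
        _ = _ := by rw [hAMi, h1]
    rw [h2]
    noncomm_ring
  have hcommn : ‖O * Mi - Li * O‖ ≤ 7 * s * lam⁻¹ := by
    have h1 : ‖(O - H) * Mi‖ ≤ (2 * s) * (2 * lam⁻¹) :=
      (Matrix.l2_opNorm_mul _ _).trans
        (mul_le_mul hOH hMn (norm_nonneg _) ((norm_nonneg _).trans hOH))
    have h2 : ‖Li * (O - H)‖ ≤ lam⁻¹ * (2 * s) :=
      (Matrix.l2_opNorm_mul _ _).trans
        (mul_le_mul hLn hOH (norm_nonneg _) ((norm_nonneg _).trans hLn))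
    have h3 : ‖Li * (Uᵀ * ((A - P) * V)) * Mi‖ ≤ s * lam⁻¹ := by
      calc _ ≤ ‖Li * (Uᵀ * ((A - P) * V))‖ * ‖Mi‖ := Matrix.l2_opNorm_mul _ _
        _ ≤ (‖Li‖ * ‖Uᵀ * ((A - P) * V)‖) * ‖Mi‖ := by gcongr; exact Matrix.l2_opNorm_mul _ _
        _ ≤ (‖Li‖ * (‖Uᵀ‖ * ‖(A - P) * V‖)) * ‖Mi‖ := by gcongr; exact Matrix.l2_opNorm_mul _ _
        _ ≤ (‖Li‖ * (‖Uᵀ‖ * (‖A - P‖ * ‖V‖))) * ‖Mi‖ := by gcongr; exact Matrix.l2_opNorm_mul _ _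
        _ ≤ (lam⁻¹ * (1 * (e * 1))) * (2 * lam⁻¹) := by
            rw [hee, opNorm_transpose]; gcongr
        _ = s * lam⁻¹ := by rw [hs]; ring
    rw [hcomm]
    calc _ ≤ ‖(O - H) * Mi‖ + ‖Li * (O - H)‖ + ‖Li * (Uᵀ * ((A - P) * V)) * Mi‖ :=
          (norm_sub_le _ _).trans (add_le_add (norm_sub_le _ _) le_rfl)
      _ ≤ (2 * s) * (2 * lam⁻¹) + lam⁻¹ * (2 * s) + s * lam⁻¹ := by gcongr
      _ = _ := by ring
  have hdecomp : V - U * O =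
      A * ((V - U * O) * Mi + U * (O * Mi - Li * O)) + (A - P) * U * (Li * O) := by
    have h1 : A * (V * Mi) = V := by rw [← Matrix.mul_assoc, hAMi]
    have h2 : P * (U * (Li * O)) = U * O := by
      rw [← Matrix.mul_assoc, ← Matrix.mul_assoc, hPLi]
    simp only [Matrix.mul_add, Matrix.sub_mul, Matrix.mul_sub, Matrix.mul_assoc, h1, h2]
    abel
  -- The constant is `(4 + 7) * s / lam` with `s = 2 * e / lam`, giving 22, just below the 23 in
  -- `betaRow`.
  have hX : ‖(V - U * O) * Mi + U * (O * Mi - Li * O)‖ ≤ 22 * (e / lam ^ 2) := by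
    calc _ ≤ ‖(V - U * O) * Mi‖ + ‖U * (O * Mi - Li * O)‖ := norm_add_le _ _
      _ ≤ ‖V - U * O‖ * ‖Mi‖ + ‖U‖ * ‖O * Mi - Li * O‖ :=
          add_le_add (Matrix.l2_opNorm_mul _ _) (Matrix.l2_opNorm_mul _ _)
      _ ≤ (2 * s) * (2 * lam⁻¹) + 1 * (7 * s * lam⁻¹) := by gcongr
      _ = 22 * (e / lam ^ 2) := by rw [hs]; field_simp; ring
  have hLO : ‖Li * O‖ ≤ lam⁻¹ := by
    calc _ ≤ ‖Li‖ * ‖O‖ := Matrix.l2_opNorm_mul _ _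
      _ ≤ lam⁻¹ * 1 := by gcongr
      _ = lam⁻¹ := mul_one _
  have hcoef : 22 ≤ 23 * √(K : ℝ) * condNum K P := by
    have h1 : 1 ≤ √(K : ℝ) := by rw [Real.one_le_sqrt]; exact_mod_cast hK
    have h2 := one_le_condNum P hK hpos
    nlinarith
  rw [betaRow, ← hlam, ← he]
  calc rowNorm (V - U * O) i
      = rowNorm (A * ((V - U * O) * Mi + U * (O * Mi - Li * O)) + (A - P) * U * (Li * O)) i := by
        rw [← hdecomp]
    _ ≤ rowNorm A i * (22 * (e / lam ^ 2)) + rowNorm ((A - P) * U) i * lam⁻¹ := by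
        refine (rowNorm_add_le _ _ _).trans (add_le_add ?_ ?_)
        · exact (rowNorm_mul_le _ _ _).trans (mul_le_mul_of_nonneg_left hX (rowNorm_nonneg _ _))
        · exact (rowNorm_mul_le _ _ _).trans (mul_le_mul_of_nonneg_left hLO (rowNorm_nonneg _ _))
    _ = 22 * (rowNorm A i * e / lam ^ 2) + rowNorm ((A - P) * U) i / lam := by ring
    _ ≤ _ := by
        gcongr
        have := rowNorm_nonneg A i
        positivity

end RowBound

/-! ### The model, preconditioned SPA on the perturbed embedding, and the final bounds. -/

section Assembly

variable {n K : ℕ}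

lemma frobNorm_le_of_rowNorm_le {m d : ℕ} {M : Matrix (Fin m) (Fin d) ℝ} {c : ℝ} (hc : 0 ≤ c)
    (h : ∀ i, rowNorm M i ≤ c) : frobNorm M ≤ √(m : ℝ) * c := by
  rw [frobNorm, Real.sqrt_le_left (by positivity), mul_pow, Real.sq_sqrt (Nat.cast_nonneg _)]
  calc ∑ i, ∑ j, M i j ^ 2 ≤ ∑ _i : Fin m, c ^ 2 := by
        refine Finset.sum_le_sum fun i _ => ?_
        have h1 : ∑ j, M i j ^ 2 = rowNorm M i ^ 2 := by
          rw [rowNorm, norm_toLp_sq, dotProduct]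
          simp_rw [pow_two]
        rw [h1]
        exact pow_le_pow_left₀ (rowNorm_nonneg M i) (h i) 2
    _ = m * c ^ 2 := by simp

lemma norm_mulVec_le_singVal_one (F : Matrix (Fin K) (Fin K) ℝ) (v : Fin K → ℝ) :
    ‖WithLp.toLp 2 (F *ᵥ v)‖ ≤ singVal F 1 * ‖WithLp.toLp 2 v‖ :=
  norm_le_singularValues_zero_mul (Matrix.toEuclideanLin F) (WithLp.toLp 2 v)

lemma singVal_mul_norm_le_norm_mulVec (F : Matrix (Fin K) (Fin K) ℝ) (v : Fin K → ℝ) :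
    singVal F K * ‖WithLp.toLp 2 v‖ ≤ ‖WithLp.toLp 2 (F *ᵥ v)‖ := by
  refine singularValues_mul_norm_le (Matrix.toEuclideanLin F) ?_ (WithLp.toLp 2 v)
  rw [finrank_euclideanSpace_fin]
  omega

/-- The lower bound for `F` is an upper bound for `F⁻¹`, and upper bounds pass to transposes. -/
lemma singVal_mul_norm_le_norm_transpose_mulVec {F : Matrix (Fin K) (Fin K) ℝ}
    (hF : IsUnit F.det) (hpos : 0 < singVal F K) (v : Fin K → ℝ) :
    singVal F K * ‖WithLp.toLp 2 v‖ ≤ ‖WithLp.toLp 2 (Fᵀ *ᵥ v)‖ := by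
  have h1 : ∀ u, ‖WithLp.toLp 2 (F⁻¹ *ᵥ u)‖ ≤ (singVal F K)⁻¹ * ‖WithLp.toLp 2 u‖ := fun u => by
    have h2 := singVal_mul_norm_le_norm_mulVec F (F⁻¹ *ᵥ u)
    rw [Matrix.mulVec_mulVec, Matrix.mul_nonsing_inv _ hF, Matrix.one_mulVec] at h2
    rwa [inv_mul_eq_div, le_div_iff₀' hpos]
  have h2 := norm_transpose_mulVec_le (inv_nonneg.mpr hpos.le) h1 (Fᵀ *ᵥ v)
  rw [Matrix.mulVec_mulVec, ← Matrix.transpose_mul, Matrix.mul_nonsing_inv _ hF,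
    Matrix.transpose_one, Matrix.one_mulVec] at h2
  rwa [inv_mul_eq_div, le_div_iff₀' hpos] at h2

lemma norm_transpose_mul_orthogonal_mulVec {O : Matrix (Fin K) (Fin K) ℝ}
    (hO : O ∈ Matrix.orthogonalGroup (Fin K) ℝ) (F : Matrix (Fin K) (Fin K) ℝ) (v : Fin K → ℝ) :
    ‖WithLp.toLp 2 ((F * O)ᵀ *ᵥ v)‖ = ‖WithLp.toLp 2 (Fᵀ *ᵥ v)‖ := by
  have h1 : O * Oᵀ = 1 := (Matrix.mem_orthogonalGroup_iff _ _).mp hO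
  rw [← sq_eq_sq₀ (norm_nonneg _) (norm_nonneg _), norm_toLp_sq, norm_toLp_sq,
    Matrix.transpose_mul, ← Matrix.mulVec_mulVec, Matrix.dotProduct_mulVec,
    ← Matrix.mulVec_transpose, Matrix.transpose_transpose, Matrix.mulVec_mulVec, h1,
    Matrix.one_mulVec]

section MMSB

variable {Θ : Matrix (Fin n) (Fin K) ℝ} {B : Matrix (Fin K) (Fin K) ℝ}
  {P : Matrix (Fin n) (Fin n) ℝ}

lemma IsIdentifiableMMSB.exists_pure_row (h : IsIdentifiableMMSB Θ B P) (k : Fin K) :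
    ∃ i, Θ i = Pi.single k 1 := by
  obtain ⟨i, hi⟩ := h.pure_node k
  refine ⟨i, funext fun l => ?_⟩
  by_cases hl : l = k
  · rw [hl, hi, Pi.single_eq_same]
  · rw [Pi.single_eq_of_ne hl]
    refine le_antisymm ?_ (h.memb_mem i l).1
    have h1 : Θ i l + Θ i k ≤ 1 := by
      rw [← h.memb_sum i, ← Finset.sum_pair hl]
      exact Finset.sum_le_univ_sum_of_nonneg fun j => (h.memb_mem i j).1
    linarith

lemma IsIdentifiableMMSB.isSymm (h : IsIdentifiableMMSB Θ B P) : P.IsSymm := by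
  rw [Matrix.IsSymm, h.model, Matrix.transpose_mul, Matrix.transpose_mul,
    Matrix.transpose_transpose, h.comm_symm, Matrix.mul_assoc]

/-- Restricting `P` to one pure node per community gives back `B`. -/
lemma IsIdentifiableMMSB.le_rank (h : IsIdentifiableMMSB Θ B P) : K ≤ P.rank := by
  choose ι hι using h.exists_pure_row
  have h1 : P.submatrix ι ι = B := by
    ext a b
    simp [h.model, Matrix.mul_apply, hι, Pi.single_apply]
  rw [← h.comm_rank, ← h1]
  exact Matrix.rank_submatrix_le _ _ _

/-- Since `F` is invertible, `U` and `Θ` have the same column space, which contains the range of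
`P`. -/
lemma mul_transpose_mul_eq_self (h : IsIdentifiableMMSB Θ B P) {U : Matrix (Fin n) (Fin K) ℝ}
    {F : Matrix (Fin K) (Fin K) ℝ} (hU : Uᵀ * U = 1) (hUF : U = Θ * F) (hF : IsUnit F.det) :
    U * (Uᵀ * P) = P := by
  have h1 : Θ = U * F⁻¹ := by
    rw [hUF, Matrix.mul_assoc, Matrix.mul_nonsing_inv _ hF, Matrix.mul_one]
  have h2 : P = U * (F⁻¹ * B * Θᵀ) := by
    calc P = Θ * B * Θᵀ := h.model
      _ = U * F⁻¹ * B * Θᵀ := by rw [← h1]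
      _ = _ := by simp only [Matrix.mul_assoc]
  conv_lhs => rw [h2]
  rw [← Matrix.mul_assoc Uᵀ, hU, Matrix.one_mul, ← h2]

end MMSB

/-- Robustness of the preconditioned successive projection algorithm: if the rows of `V` are convex
combinations `Θ F O` of the rows of `F O`, each of which occurs among them, up to errors of norm at
most `ε`, then the selected rows are close to the rows of `F O`. -/
theorem precondSPA_near_vertices (hK : 0 < K) {Θ : Matrix (Fin n) (Fin K) ℝ}
    (hΘ0 : ∀ i k, 0 ≤ Θ i k) (hΘ1 : ∀ i, ∑ k, Θ i k = 1) (hpure : ∀ k, ∃ i, Θ i = Pi.single k 1)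
    {F O : Matrix (Fin K) (Fin K) ℝ} (hF : IsUnit F.det)
    (hO : O ∈ Matrix.orthogonalGroup (Fin K) ℝ) {V : Matrix (Fin n) (Fin K) ℝ} {ε : ℝ}
    (hε0 : 0 ≤ ε) (hε : ε ≤ 1 / 30000 * (singVal F K / √(K : ℝ)))
    (hV : ∀ i, rowNorm (V - Θ * F * O) i ≤ ε) {J : Fin K → Fin n}
    (hJ : IsPrecondSPAOutput Vᵀ J) :
    Function.Injective J ∧ ∃ π : Equiv.Perm (Fin K),
      ∀ j, ‖WithLp.toLp 2 (V (J j) - (F * O) (π j))‖ ≤ 641 * condNum K F * ε := by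
  have hFpos : 0 < singVal F K := by
    refine singVal_pos_of_le_rank F hK ?_
    rw [Matrix.rank_of_isUnit _ ((Matrix.isUnit_iff_isUnit_det _).mpr hF), Fintype.card_fin]
  have hK1 : 1 ≤ √(K : ℝ) := by
    rw [Real.one_le_sqrt]; exact_mod_cast hK
  set W := (F * O)ᵀ with hW
  have hWdet : IsUnit W.det := by
    rw [hW, Matrix.det_transpose, Matrix.det_mul]
    refine hF.mul ?_
    exact (Matrix.isUnit_iff_isUnit_det _).mp
      (IsUnit.of_mul_eq_one _ ((Matrix.mem_orthogonalGroup_iff _ _).mp hO))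
  have hWl : ∀ v, singVal F K * ‖WithLp.toLp 2 v‖ ≤ ‖WithLp.toLp 2 (W *ᵥ v)‖ := fun v => by
    rw [hW, norm_transpose_mul_orthogonal_mulVec hO]
    exact singVal_mul_norm_le_norm_transpose_mulVec hF hFpos v
  have hWu : ∀ v, ‖WithLp.toLp 2 (W *ᵥ v)‖ ≤ singVal F 1 * ‖WithLp.toLp 2 v‖ := fun v => by
    rw [hW, norm_transpose_mul_orthogonal_mulVec hO]
    exact norm_transpose_mulVec_le (LinearMap.singularValues_nonneg _ _)
      (norm_mulVec_le_singVal_one F) v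
  set δ := ε / singVal F K with hδ
  have hδ0 : 0 ≤ δ := by positivity
  have hδK : √(K : ℝ) * δ ≤ 1 / 30000 := by
    rw [hδ, ← mul_div_assoc, div_le_iff₀ hFpos]
    rw [← mul_div_assoc, le_div_iff₀ (by linarith)] at hε
    linarith
  have hδ1 : δ ≤ 1 / 30000 := by nlinarith
  set Z := W⁻¹ * Vᵀ with hZ
  have hWZ : W * Z = Vᵀ := by
    rw [hZ, ← Matrix.mul_assoc, Matrix.mul_nonsing_inv _ hWdet, Matrix.one_mul]
  have hrow : ∀ i, (Θ * F * O) i = W *ᵥ Θ i := fun i => by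
    rw [hW, Matrix.mulVec_transpose, Matrix.mul_assoc, Matrix.mul_apply_eq_vecMul]
  have hZrow : ∀ i, W *ᵥ (Zᵀ i - Θ i) = (V - Θ * F * O) i := fun i => by
    rw [Matrix.mulVec_sub, ← mul_transpose_row, hWZ, ← hrow]
    rfl
  have hZn : ∀ i, ‖WithLp.toLp 2 (Zᵀ i - Θ i)‖ ≤ δ := fun i => by
    rw [hδ, le_div_iff₀' hFpos]
    refine (hWl _).trans ?_
    rw [hZrow]
    exact hV i
  obtain ⟨Q, hQmin, hQout⟩ := hJ
  rw [← hWZ] at hQmin hQout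
  -- Factors of the ellipsoid matrix need not be symmetric, so `Q * W` is itself an admissible
  -- preconditioner for `Z`, and `(Q * W) * Z` is exactly the input SPA sees.
  have hmin : IsMinVolEllipsoid Z ((Q * W)ᵀ * (Q * W)) := by
    have h1 := hQmin.of_mul hWdet
    rwa [← Matrix.mul_assoc, ← Matrix.transpose_mul, Matrix.mul_assoc] at h1
  rw [← Matrix.mul_assoc] at hQout
  obtain ⟨hYl, hYu⟩ := hmin.conditioning_of_near_separable hK Θ hΘ0 hΘ1 hpure hδ0 hZn hδK
  obtain ⟨p, hp, hpJ⟩ := spa_near_vertices (Matrix.toEuclideanLin (Q * W))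
    (fun v => hYl v.ofLp) (fun v => hYu v.ofLp) (fun j => WithLp.toLp 2 (Θ j))
    (fun j => WithLp.toLp 2 (Zᵀ j - Θ j)) hΘ0 hΘ1
    (fun l => (hpure l).imp fun j hj => by rw [hj]; rfl) hδ0 hZn hδK (Q * W * Z)
    (fun j => by
      rw [mul_transpose_row, ← WithLp.toLp_add, add_sub_cancel]
      rfl) J hQout
  refine ⟨fun i i' hii => ?_, Equiv.ofBijective p (Finite.injective_iff_bijective.mp hp),
    fun j => ?_⟩
  -- A repeated index would place weight above 1/2 on two different vertices.
  · by_contra hne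
    have h1 := hpJ i
    have h2 := hpJ i'
    rw [← hii] at h2
    have h3 : Θ (J i) (p i) + Θ (J i) (p i') ≤ 1 := by
      rw [← hΘ1 (J i), ← Finset.sum_pair (hp.ne hne)]
      exact Finset.sum_le_univ_sum_of_nonneg (hΘ0 _)
    dsimp only at h1 h2
    linarith
  · rw [Equiv.ofBijective_apply]
    have h1 : V (J j) - (F * O) (p j) =
        (V - Θ * F * O) (J j) + W *ᵥ (Θ (J j) - Pi.single (p j) 1) := by
      rw [Matrix.mulVec_sub, ← hrow, Matrix.mulVec_single_one]
      exact (sub_add_sub_cancel _ _ _).symm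
    have h2 : ‖WithLp.toLp 2 (Θ (J j) - Pi.single (p j) 1)‖ ≤ 2 * (1 - Θ (J j) (p j)) :=
      norm_sub_single_le (WithLp.toLp 2 (Θ (J j))) (hΘ0 _) (hΘ1 _) (p j)
    have h3 : ‖WithLp.toLp 2 (Θ (J j) - Pi.single (p j) 1)‖ ≤ 640 * δ := by
      have := hpJ j
      dsimp only at this
      linarith
    have hs1 : 0 ≤ singVal F 1 := LinearMap.singularValues_nonneg _ _
    -- `δ` divides by the smallest singular value and `W` multiplies by the largest, which produces
    -- the condition number. The noise `ε` accounts for the step from 640 to 641.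
    have h4 : singVal F 1 * (640 * δ) = 640 * condNum K F * ε := by
      rw [hδ, condNum]; field_simp
    have h5 := one_le_condNum F hK hFpos
    rw [h1, WithLp.toLp_add]
    refine (norm_add_le _ _).trans ?_
    have h6 := (hWu (Θ (J j) - Pi.single (p j) 1)).trans (mul_le_mul_of_nonneg_left h3 hs1)
    rw [h4] at h6
    have h7 : ‖WithLp.toLp 2 ((V - Θ * F * O) (J j))‖ ≤ ε := hV (J j)
    nlinarith

lemma betaRow_nonneg (A P : Matrix (Fin n) (Fin n) ℝ) (U : Matrix (Fin n) (Fin K) ℝ) (i : Fin n) :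
    0 ≤ betaRow A P U i := by
  have h1 : ∀ k, 0 ≤ singVal P k := fun k => LinearMap.singularValues_nonneg _ _
  have h2 : 0 ≤ condNum K P := div_nonneg (h1 _) (h1 _)
  have h3 := rowNorm_nonneg A i
  have h4 := rowNorm_nonneg ((A - P) * U) i
  have h5 : 0 ≤ specNorm (A - P) := norm_nonneg _
  have h6 := h1 K
  unfold betaRow
  positivity

lemma betaRow_le_beta (A P : Matrix (Fin n) (Fin n) ℝ) (U : Matrix (Fin n) (Fin K) ℝ) (i : Fin n) :
    betaRow A P U i ≤ beta A P U :=
  le_ciSup (f := fun i => betaRow A P U i) (Finite.bddAbove_range _) i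

end Assembly

end SPOC

theorem corollary1 :
    ∃ c₁ C₀ : ℝ, 0 < c₁ ∧ 0 < C₀ ∧
      ∀ (n K : ℕ) (Θ : Matrix (Fin n) (Fin K) ℝ) (B : Matrix (Fin K) (Fin K) ℝ)
        (A P : Matrix (Fin n) (Fin n) ℝ) (U Uhat : Matrix (Fin n) (Fin K) ℝ)
        (F : Matrix (Fin K) (Fin K) ℝ),
        0 < K →
        SPOC.IsIdentifiableMMSB Θ B P →
        A.IsSymm →
        SPOC.IsLeadingEigenvectors P U →
        SPOC.IsLeadingEigenvectors A Uhat →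
        U = Θ * F →
        SPOC.specNorm (A - P) ≤ SPOC.singVal P K / 2 →
        SPOC.beta A P U ≤ c₁ * (SPOC.singVal F K / √(K : ℝ)) →
        ∃ O ∈ Matrix.orthogonalGroup (Fin K) ℝ,
          (∀ i, SPOC.rowNorm (Uhat - U * O) i ≤ SPOC.betaRow A P U i) ∧
          (∃ J : Fin K → Fin n, SPOC.IsPrecondSPAOutput Uhatᵀ J) ∧
          ∀ J : Fin K → Fin n, SPOC.IsPrecondSPAOutput Uhatᵀ J →
            Function.Injective J ∧
            ∃ π : Equiv.Perm (Fin K),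
              (∀ j, ‖WithLp.toLp 2 (Uhat (J j) - (F * O) (π j))‖
                ≤ C₀ * SPOC.condNum K F * SPOC.beta A P U) ∧
              SPOC.frobNorm (Uhat.submatrix J id - π.permMatrix ℝ * F * O)
                ≤ C₀ * √(K : ℝ) * SPOC.condNum K F * SPOC.beta A P U := by
  -- The value 1/30000 is not optimised: it ensures, among others, `97 * √K * δ ≤ 1/10`, `641 * √K *
  -- δ ≤ 1/2` and `1282 * δ ≤ 1/8`.
  refine ⟨1 / 30000, 641, by norm_num, by norm_num, ?_⟩
  intro n K Θ B A P U Uhat F hK hMM hA hU hUhat hUF hAP hβ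
  have hFdet : IsUnit F.det := by
    have h1 : (Uᵀ * Θ) * F = 1 := by rw [Matrix.mul_assoc, ← hUF, hU.1]
    exact Matrix.isUnit_det_of_left_inverse h1
  have hpos : 0 < SPOC.singVal P K := SPOC.singVal_pos_of_le_rank P hK hMM.le_rank
  obtain ⟨O, hO, hrow⟩ := SPOC.exists_orthogonal_rowNorm_le hA hMM.isSymm hU hUhat hK
    (SPOC.mul_transpose_mul_eq_self hMM hU.1 hUF hFdet) hpos hAP
  -- A pure node shows that there is at least one row, which makes the supremum `beta` nonnegative
  -- and gives SPA a column to select.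
  obtain ⟨i₀, -⟩ := hMM.pure_node ⟨0, hK⟩
  have hβ0 : 0 ≤ SPOC.beta A P U :=
    (SPOC.betaRow_nonneg A P U i₀).trans (SPOC.betaRow_le_beta A P U i₀)
  refine ⟨O, hO, hrow, ?_, fun J hJ => ?_⟩
  · have : NeZero n := ⟨fun h0 => by subst h0; exact i₀.elim0⟩
    obtain ⟨Q, hQ⟩ := SPOC.exists_isMinVolEllipsoid Uhatᵀ Uhat hUhat.1
    obtain ⟨J, hJ⟩ := SPOC.exists_isSPAOutput (Q * Uhatᵀ) K
    exact ⟨J, Q, hQ, hJ⟩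
  · obtain ⟨hinj, π, hπ⟩ := SPOC.precondSPA_near_vertices hK (fun i k => (hMM.memb_mem i k).1)
      hMM.memb_sum hMM.exists_pure_row hFdet hO hβ0 hβ
      (fun i => by rw [← hUF]; exact (hrow i).trans (SPOC.betaRow_le_beta A P U i)) hJ
    refine ⟨hinj, π, hπ, ?_⟩
    have hc : 0 ≤ 641 * SPOC.condNum K F * SPOC.beta A P U :=
      (norm_nonneg _).trans (hπ ⟨0, hK⟩)
    have h1 := SPOC.frobNorm_le_of_rowNorm_le
      (M := Uhat.submatrix J id - π.permMatrix ℝ * F * O) hc fun j => by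
        have h2 : (Uhat.submatrix J id - π.permMatrix ℝ * F * O) j =
            Uhat (J j) - (F * O) (π j) := by
          rw [Matrix.mul_assoc, Equiv.Perm.permMatrix, PEquiv.toMatrix_toPEquiv_mul]
          rfl
        rw [SPOC.rowNorm, h2]
        exact hπ j
    linarith
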